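/- Let $n\ge 2$ be an integer, write $B_r=\{x\in\mathbb R^n:|x|<r\}$, and let $f\in C^1(\mathbb R)$. A function $u\in W^{1,1}_{\rm loc}(B_2)$ is called a stable solution of $$\operatorname{div}\left(\frac{\nabla u}{\sqrt{1+|\nabla u|^2}}\right)=-f(u)\quad\text{in } B_2$$ if $f(u),f'(u)\in L^1_{\rm loc}(B_2)$, the equation holds weakly, i.e. $$\int_{B_2}\frac{\nabla u\cdot\nabla\varphi}{\sqrt{1+|\nabla u|^2}}\,dx=\int_{B_2}f(u)\varphi\,dx\qquad\text{for all }\varphi\in C_c^\infty(B_2),$$ and $$\int_{B_2}f'(u)\xi^2\,dx\le\int_{B_2}\left(\frac{|\nabla\xi|^2}{\sqrt{1+|\nabla u|^2}}-\frac{(\nabla u\cdot\nabla\xi)^2}{(1+|\nabla u|^2)^{3/2}}\right)dx\qquad\text{for all }\xi\in C_c^\infty(B_2).$$ Proposition. For every $n\ge2$ and every $\alpha\in(0,1)$ there is a constant $K=K(n,\alpha)>0$, depending only on $n$ and $\alpha$, such that the following holds: for every $f\in C^1(\mathbb R)$ and every stable solution $u\in W^{3,1}_{\rm loc}(B_2)$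 of this equation in $B_2$ that is radially symmetric with respect to the origin, $$\int_{B_\rho}|\nabla u|\,dx\le K\rho^{\,n-1+\alpha}\qquad\text{for all }0<\rho<1.$$ -/

import Mathlib

open MeasureTheory
open scoped ContDiff

namespace MeanCurvature

/-- `φ ∈ C_c^∞(Ω)`. -/
structure IsTestFunction {n : ℕ} (Ω : Set (EuclideanSpace ℝ (Fin n)))
    (φ : EuclideanSpace ℝ (Fin n) → ℝ) : Prop where
  smooth : ContDiff ℝ ∞ φ
  compact : HasCompactSupport φ
  subset : tsupport φ ⊆ Ω

/-- `u ∈ W^{1,1}_loc(Ω)` and `Du` is (a representative of) its weak gradient in `Ω`. -/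
structure HasWeakGradient {n : ℕ} (Ω : Set (EuclideanSpace ℝ (Fin n)))
    (u : EuclideanSpace ℝ (Fin n) → ℝ)
    (Du : EuclideanSpace ℝ (Fin n) → EuclideanSpace ℝ (Fin n)) : Prop where
  locInt : LocallyIntegrableOn u Ω volume
  locInt_grad : LocallyIntegrableOn Du Ω volume
  integral_eq : ∀ φ : EuclideanSpace ℝ (Fin n) → ℝ, IsTestFunction Ω φ → ∀ i : Fin n,
    ∫ x in Ω, u x * gradient φ x i = -∫ x in Ω, Du x i * φ x

/-- `u ∈ W^{k,1}_loc(Ω)`: all weak partial derivatives of `u` of order at most `k` exist and are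
locally integrable in `Ω`. -/
def MemSobolevLoc {n : ℕ} (Ω : Set (EuclideanSpace ℝ (Fin n))) :
    ℕ → (EuclideanSpace ℝ (Fin n) → ℝ) → Prop
  | 0, u => LocallyIntegrableOn u Ω volume
  | k + 1, u => ∃ Du : EuclideanSpace ℝ (Fin n) → EuclideanSpace ℝ (Fin n),
      HasWeakGradient Ω u Du ∧ ∀ i : Fin n, MemSobolevLoc Ω k (fun x => Du x i)

/-- `u`, with weak gradient `Du`, is a weak solution of
`div (∇u / √(1 + |∇u|²)) = -f(u)` in `Ω`. -/
structure IsWeakSolution {n : ℕ} (f : ℝ → ℝ) (Ω : Set (EuclideanSpace ℝ (Fin n)))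
    (u : EuclideanSpace ℝ (Fin n) → ℝ)
    (Du : EuclideanSpace ℝ (Fin n) → EuclideanSpace ℝ (Fin n)) : Prop where
  weakGradient : HasWeakGradient Ω u Du
  locInt_f : LocallyIntegrableOn (fun x => f (u x)) Ω volume
  equation : ∀ φ : EuclideanSpace ℝ (Fin n) → ℝ, IsTestFunction Ω φ →
    ∫ x in Ω, inner ℝ (Du x) (gradient φ x) / √(1 + ‖Du x‖ ^ 2) = ∫ x in Ω, f (u x) * φ x

/-- `u`, with weak gradient `Du`, is a stable solution of
`div (∇u / √(1 + |∇u|²)) = -f(u)` in `Ω`. -/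
structure IsStableSolution {n : ℕ} (f : ℝ → ℝ) (Ω : Set (EuclideanSpace ℝ (Fin n)))
    (u : EuclideanSpace ℝ (Fin n) → ℝ)
    (Du : EuclideanSpace ℝ (Fin n) → EuclideanSpace ℝ (Fin n)) : Prop
    extends IsWeakSolution f Ω u Du where
  locInt_deriv : LocallyIntegrableOn (fun x => deriv f (u x)) Ω volume
  stable : ∀ ξ : EuclideanSpace ℝ (Fin n) → ℝ, IsTestFunction Ω ξ →
    ∫ x in Ω, deriv f (u x) * ξ x ^ 2 ≤
      ∫ x in Ω, (‖gradient ξ x‖ ^ 2 / √(1 + ‖Du x‖ ^ 2)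
        - inner ℝ (Du x) (gradient ξ x) ^ 2 / (1 + ‖Du x‖ ^ 2) ^ (3 / 2 : ℝ))

/-- `u` is (almost everywhere equal to) a function of `|x|` in `Ω`. -/
def IsRadialOn {n : ℕ} (Ω : Set (EuclideanSpace ℝ (Fin n)))
    (u : EuclideanSpace ℝ (Fin n) → ℝ) : Prop :=
  ∃ g : ℝ → ℝ, ∀ᵐ x ∂(volume.restrict Ω), u x = g ‖x‖

end MeanCurvature

namespace MeanCurvature

open Set

/-! Write u = G(|x|), v = G', m = n - 1 and φ(v) = v/√(1+v²). The equation becomes (r^m φ(v))' =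
-r^m f(G), and differentiating it shows that v solves the linearised equation up to the extra term m
r^m φ(v)/r². Testing stability with vη therefore cancels the f' terms and leaves m ∫ r^m φ(v) v r⁻²
η² ≤ ∫ r^m φ'(v) v² η'² (`profile_stability_inequality`).

The degeneracy of the operator now helps. Since φ'(v)v² ≤ 1, the right side is bounded independently
of u and f, while φ(v)v on the left still controls |v| up to a constant (`abs_le_one_add_flux_mul`).
Take for η a truncation of r^(-β) with 2β = m - 2 + α. The right side is then at most a multiple of
∫ r^(-α), finite because α < 1 and uniform in the truncation near 0. The left side contains ∫ r^(-α)
φ(v)v, and r^m ≤ ρ^(m+α) r^(-α) for r < ρ turns this into the estimate (`exists_profile_bound`).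
Nothing has to be absorbed, so all dimensions are treated alike.

The rest is regularity, obtained in annuli away from the origin. Radial test fields express the
second distributional derivative of the profile through the radial mass of an integrable function,
which has a C^1 second primitive; hence the profile is C^1 (`exists_contDiff_profile`). The equation
then makes the flux C^1 (`hasDerivAt_of_weak`), inverting φ makes v itself C^1
(`contDiffAt_of_flux`), and mollification admits vη as a test function (`integral_sq_le_of_testOn`).
The inner radius of the annulus tends to 0 only at the very end. -/

theorem deriv_eq_zero_of_notMem_Icc {c d : ℝ} {w : ℝ → ℝ} (hw : ∀ x, x ∉ Icc c d → w x = 0)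
    {x : ℝ} (hx : x ∉ Icc c d) : deriv w x = 0 := by
  have : w =ᶠ[nhds x] fun _ => 0 := by
    filter_upwards [isClosed_Icc.isOpen_compl.mem_nhds hx] with y hy using hw y hy
  rw [this.deriv_eq]; simp

theorem contDiff_primitive {F : ℝ → ℝ} (hF : Continuous F) (a : ℝ) :
    ContDiff ℝ 1 (fun r => ∫ s in a..r, F s) ∧
      ∀ r, HasDerivAt (fun r => ∫ s in a..r, F s) (F r) r := by
  have hd : ∀ r, HasDerivAt (fun r => ∫ s in a..r, F s) (F r) r := fun r =>
    intervalIntegral.integral_hasDerivAt_right (hF.intervalIntegrable _ _)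
      (hF.stronglyMeasurableAtFilter _ _) hF.continuousAt
  refine ⟨contDiff_one_iff_deriv.2 ⟨fun r => (hd r).differentiableAt, ?_⟩, hd⟩
  rw [funext fun r => (hd r).deriv]
  exact hF

/-! ### Test functions of one variable and lemmas of du Bois-Reymond type. -/

/-- `χ ∈ C_c^∞(a, b)`. -/
structure TestOn (a b : ℝ) (χ : ℝ → ℝ) : Prop where
  smooth : ContDiff ℝ ∞ χ
  supp : ∃ c d, a < c ∧ d < b ∧ ∀ x, x ∉ Icc c d → χ x = 0

namespace TestOn

variable {a b : ℝ} {χ ψ : ℝ → ℝ}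

theorem continuous (h : TestOn a b χ) : Continuous χ := h.smooth.continuous

theorem eq_zero (h : TestOn a b χ) {x : ℝ} (hx : x ∉ Ioo a b) : χ x = 0 := by
  obtain ⟨c, d, hc, hd, h0⟩ := h.supp
  exact h0 x fun hx' => hx ⟨hc.trans_le hx'.1, hx'.2.trans_lt hd⟩

theorem tsupport_subset (h : TestOn a b χ) : tsupport χ ⊆ Ioo a b := by
  obtain ⟨c, d, hc, hd, h0⟩ := h.supp
  have : tsupport χ ⊆ Icc c d := closure_minimal
    (fun x hx => by by_contra hx'; exact hx (h0 x hx')) isClosed_Icc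
  exact this.trans fun x hx => ⟨hc.trans_le hx.1, hx.2.trans_lt hd⟩

theorem hasCompactSupport (h : TestOn a b χ) : HasCompactSupport χ := by
  obtain ⟨c, d, -, -, h0⟩ := h.supp
  exact HasCompactSupport.intro isCompact_Icc h0

theorem of_tsupport_subset (hs : ContDiff ℝ ∞ χ) (hc : HasCompactSupport χ)
    (ht : tsupport χ ⊆ Ioo a b) : TestOn a b χ := by
  refine ⟨hs, ?_⟩
  rcases (tsupport χ).eq_empty_or_nonempty with h | h
  -- For χ = 0 any c > a and d < b will do: c ≤ d is not required.
  · refine ⟨a + 1, b - 1, by linarith, by linarith, fun x _ => ?_⟩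
    exact image_eq_zero_of_notMem_tsupport (by simp [h])
  · obtain ⟨c, hc1, hc2⟩ := hc.isCompact.exists_isLeast h
    obtain ⟨d, hd1, hd2⟩ := hc.isCompact.exists_isGreatest h
    exact ⟨c, d, (ht hc1).1, (ht hd1).2, fun x hx =>
      image_eq_zero_of_notMem_tsupport fun hx' => hx ⟨hc2 hx', hd2 hx'⟩⟩

theorem deriv (h : TestOn a b χ) : TestOn a b (deriv χ) := by
  obtain ⟨c, d, hc, hd, h0⟩ := h.supp
  refine ⟨(contDiff_infty_iff_deriv.1 h.smooth).2, c, d, hc, hd, fun _ hx =>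
    deriv_eq_zero_of_notMem_Icc h0 hx⟩

theorem hasDerivAt (h : TestOn a b χ) (x : ℝ) : HasDerivAt χ (_root_.deriv χ x) x :=
  (h.smooth.differentiable (by simp) x).hasDerivAt

/-- A test function stays one after multiplication by a function smooth on `(a, b)`. -/
theorem mul_left (h : TestOn a b χ) {p : ℝ → ℝ} (hp : ∀ x ∈ Ioo a b, ContDiffAt ℝ ∞ p x) :
    TestOn a b (fun x => p x * χ x) := by
  obtain ⟨c, d, hc, hd, h0⟩ := h.supp
  refine ⟨contDiff_iff_contDiffAt.2 fun x => ?_, c, d, hc, hd, fun x hx => by simp [h0 x hx]⟩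
  by_cases hx : x ∈ Ioo a b
  · exact (hp x hx).mul h.smooth.contDiffAt
  · have : (fun x => p x * χ x) =ᶠ[nhds x] fun _ => 0 := by
      have hx' : x ∉ Icc c d := fun hx' => hx ⟨hc.trans_le hx'.1, hx'.2.trans_lt hd⟩
      filter_upwards [isClosed_Icc.isOpen_compl.mem_nhds hx'] with y hy
      simp [h0 y hy]
    exact contDiffAt_const.congr_of_eventuallyEq this

theorem add (h : TestOn a b χ) (h' : TestOn a b ψ) : TestOn a b (fun x => χ x + ψ x) := by
  refine of_tsupport_subset (h.smooth.add h'.smooth) (h.hasCompactSupport.add h'.hasCompactSupport)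
    ((tsupport_add _ _).trans (union_subset h.tsupport_subset h'.tsupport_subset))

theorem const_mul (h : TestOn a b χ) (k : ℝ) : TestOn a b (fun x => k * χ x) :=
  h.mul_left fun _ _ => contDiffAt_const

theorem integrable (h : TestOn a b χ) : Integrable χ :=
  h.continuous.integrable_of_hasCompactSupport h.hasCompactSupport

theorem integrable_mul (h : TestOn a b χ) {g : ℝ → ℝ} (hg : IntegrableOn g (Ioo a b)) :
    Integrable (fun x => g x * χ x) := by
  have h1 : IntegrableOn (fun x => g x * χ x) (Ioo a b) := by
    obtain ⟨C, hC⟩ := h.hasCompactSupport.exists_bound_of_continuous h.continuous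
    exact hg.mul_bdd (c := C) h.continuous.aestronglyMeasurable (ae_of_all _ hC)
  refine (integrableOn_iff_integrable_of_support_subset fun x hx => ?_).1 h1
  by_contra hx'
  exact hx (by simp [h.eq_zero hx'])

/-- Mean zero is exactly what makes the primitive from the left vanish again to the right of the
support. -/
theorem exists_primitive (h : TestOn a b χ) (h0 : ∫ x, χ x = 0) :
    ∃ ψ, TestOn a b ψ ∧ _root_.deriv ψ = χ := by
  obtain ⟨c, d, hc, hd, hz⟩ := h.supp
  have hder : ∀ x, HasDerivAt (fun x => ∫ t in c..x, χ t) (χ x) x := 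
    (contDiff_primitive h.continuous c).2
  have hder' : _root_.deriv (fun x => ∫ t in c..x, χ t) = χ := funext fun x => (hder x).deriv
  refine ⟨fun x => ∫ t in c..x, χ t, ⟨?_, c, d, hc, hd, fun x hx => ?_⟩, hder'⟩
  · exact contDiff_infty_iff_deriv.2 ⟨fun x => (hder x).differentiableAt, by rw [hder']; exact h.smooth⟩
  · by_cases hxc : x < c
    · rw [intervalIntegral.integral_symm, intervalIntegral.integral_of_le hxc.le,
        setIntegral_congr_ae (g := fun _ => 0) measurableSet_Ioc]
      · simp
      · filter_upwards [compl_mem_ae_iff.2 (measure_singleton c)] with t ht ht'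
        exact hz t fun h' => ht (le_antisymm ht'.2 h'.1)
    · have hxd : d < x := by
        by_contra hxd
        exact hx ⟨not_lt.1 hxc, not_lt.1 hxd⟩
      rw [intervalIntegral.integral_of_le (not_lt.1 hxc), ← integral_Icc_eq_integral_Ioc,
        setIntegral_eq_integral_of_forall_compl_eq_zero, h0]
      exact fun y hy => hz y fun h' => hy ⟨h'.1, h'.2.trans hxd.le⟩

end TestOn

theorem exists_testOn_integral_eq_one {a b : ℝ} (hab : a < b) :
    ∃ θ, TestOn a b θ ∧ ∫ x, θ x = 1 := by
  let φ : ContDiffBump ((a + b) / 2) := ⟨(b - a) / 8, (b - a) / 4, by linarith, by linarith⟩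
  refine ⟨φ.normed volume, ⟨φ.contDiff_normed, (a + b) / 2 - (b - a) / 4,
    (a + b) / 2 + (b - a) / 4, by linarith, by linarith, fun x hx => ?_⟩, φ.integral_normed⟩
  apply image_eq_zero_of_notMem_tsupport
  rw [φ.tsupport_normed_eq, Real.closedBall_eq_Icc]
  exact hx

theorem ae_eq_zero_of_testOn {a b : ℝ} {h : ℝ → ℝ} (hh : IntegrableOn h (Ioo a b))
    (H : ∀ χ, TestOn a b χ → ∫ x, h x * χ x = 0) : ∀ᵐ x, x ∈ Ioo a b → h x = 0 := by
  refine isOpen_Ioo.ae_eq_zero_of_integral_contDiff_smul_eq_zero hh.locallyIntegrableOn ?_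
  intro χ h1 h2 h3
  simpa [mul_comm] using H χ (.of_tsupport_subset h1 h2 h3)

/-- The lemma of du Bois-Reymond. -/
theorem ae_eq_const_of_integral_deriv {a b : ℝ} (hab : a < b) {h : ℝ → ℝ}
    (hh : IntegrableOn h (Ioo a b)) (H : ∀ χ, TestOn a b χ → ∫ x, h x * deriv χ x = 0) :
    ∃ c, ∀ᵐ x, x ∈ Ioo a b → h x = c := by
  obtain ⟨θ, hθ, hθ1⟩ := exists_testOn_integral_eq_one hab
  refine ⟨∫ x, h x * θ x, ?_⟩
  have hh' : IntegrableOn (fun x => h x - ∫ x, h x * θ x) (Ioo a b) :=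
    hh.sub (integrableOn_const (by simp))
  have := ae_eq_zero_of_testOn hh' fun χ hχ => ?_
  · filter_upwards [this] with x hx hx' using sub_eq_zero.1 (hx hx')
  -- Subtracting (∫χ)θ gives mean zero, so the corrected function is a derivative to which `H`
  -- applies.
  obtain ⟨ψ, hψ, hd⟩ := (hχ.add (hθ.const_mul (-∫ x, χ x))).exists_primitive (by
    rw [integral_add hχ.integrable (hθ.const_mul _).integrable, integral_const_mul, hθ1]; ring)
  have h2 := H ψ hψ
  rw [hd] at h2
  have h3 : ∫ x, (h x * χ x + (-∫ x, χ x) * (h x * θ x)) = 0 := by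
    rw [← h2]; congr with x; ring
  rw [integral_add (hχ.integrable_mul hh) ((hθ.integrable_mul hh).const_mul _),
    integral_const_mul] at h3
  have h4 : ∫ x, (h x - ∫ x, h x * θ x) * χ x
      = ∫ x, (h x * χ x - (∫ x, h x * θ x) * χ x) := by congr with x; ring
  rw [h4, integral_sub (hχ.integrable_mul hh) (hχ.integrable.const_mul _), integral_const_mul]
  linarith

theorem integral_id_mul_deriv {a b : ℝ} {χ : ℝ → ℝ} (hχ : TestOn a b χ) :
    ∫ x, x * deriv χ x = -∫ x, χ x := by
  have := integral_mul_deriv_eq_deriv_mul_of_integrable (u := fun x => x) (v := χ)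
    (u' := fun _ => 1) (v' := deriv χ)
    (fun x _ => hasDerivAt_id x) (fun x _ => hχ.hasDerivAt x)
    (hχ.deriv.mul_left (p := fun x => x) fun _ _ => contDiffAt_id).integrable
    (by simpa [Pi.mul_def] using hχ.integrable)
    (hχ.mul_left (p := fun x => x) fun _ _ => contDiffAt_id).integrable
  simpa using this

/-- The second order version of the lemma of du Bois-Reymond. -/
theorem ae_eq_affine_of_integral_deriv_deriv {a b : ℝ} (hab : a < b) {h : ℝ → ℝ}
    (hh : IntegrableOn h (Ioo a b))
    (H : ∀ χ, TestOn a b χ → ∫ x, h x * deriv (deriv χ) x = 0) :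
    ∃ c e, ∀ᵐ x, x ∈ Ioo a b → h x = c + e * x := by
  obtain ⟨θ, hθ, hθ1⟩ := exists_testOn_integral_eq_one hab
  -- Minus the slope of the affine function. With ψ' = χ - (∫χ)θ the hypothesis gives ∫ hχ' = m∫χ =
  -- -m∫xχ', so h + mx falls under the first-order lemma.
  set m := ∫ x, h x * deriv θ x with hm
  have hlin : IntegrableOn (fun x => m * x) (Ioo a b) :=
    ((continuous_const.mul continuous_id).integrableOn_Icc (a := a) (b := b)).mono_set
      Ioo_subset_Icc_self
  obtain ⟨c, hc⟩ := ae_eq_const_of_integral_deriv hab (h := fun x => h x + m * x)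
    (hh.add hlin) fun χ hχ => by
      obtain ⟨ψ, hψ, hd⟩ := (hχ.add (hθ.const_mul (-∫ x, χ x))).exists_primitive (by
        rw [integral_add hχ.integrable (hθ.const_mul _).integrable, integral_const_mul, hθ1]
        ring)
      have h2 := H ψ hψ
      rw [hd] at h2
      have h3 : ∫ x, (h x * deriv χ x + (-∫ x, χ x) * (h x * deriv θ x)) = 0 := by
        rw [← h2]; congr with x
        have h5 : HasDerivAt (fun x => χ x + (-∫ x, χ x) * θ x) _ x :=
          (hχ.hasDerivAt x).add ((hθ.hasDerivAt x).const_mul (-∫ x, χ x))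
        rw [h5.deriv]; ring
      rw [integral_add (hχ.deriv.integrable_mul hh) ((hθ.deriv.integrable_mul hh).const_mul _),
        integral_const_mul] at h3
      have h4 : ∫ x, (h x + m * x) * deriv χ x
          = ∫ x, (h x * deriv χ x + m * (x * deriv χ x)) := by congr with x; ring
      rw [h4, integral_add (hχ.deriv.integrable_mul hh)
        ((hχ.deriv.mul_left (p := fun x => x) fun _ _ => contDiffAt_id).integrable.const_mul _),
        integral_const_mul, integral_id_mul_deriv hχ]
      linarith
  refine ⟨c, -m, ?_⟩
  filter_upwards [hc] with x hx hx'
  linarith [hx hx']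

/-- A `C^1` function with compact support in `(a, b)` is a limit, together with its derivative,
of a bounded sequence in `C_c^∞(a, b)`. -/
theorem exists_testOn_tendsto {a b c d : ℝ} (hac : a < c) (hdb : d < b) {w : ℝ → ℝ}
    (hw : ContDiff ℝ 1 w) (hw0 : ∀ x, x ∉ Icc c d → w x = 0) :
    ∃ (χ : ℕ → ℝ → ℝ) (M : ℝ), (∀ k, TestOn a b (χ k)) ∧
      (∀ k x, |χ k x| ≤ M) ∧ (∀ k x, |deriv (χ k) x| ≤ M) ∧
      (∀ x, Filter.Tendsto (fun k => χ k x) Filter.atTop (nhds (w x))) ∧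
      ∀ x, Filter.Tendsto (fun k => deriv (χ k) x) Filter.atTop (nhds (deriv w x)) := by
  have hcs : HasCompactSupport w := HasCompactSupport.intro isCompact_Icc hw0
  have hwc : Continuous w := hw.continuous
  have hdc : Continuous (deriv w) := hw.continuous_deriv le_rfl
  obtain ⟨M₁, hM₁⟩ := hcs.exists_bound_of_continuous hwc
  obtain ⟨M₂, hM₂⟩ := hcs.deriv.exists_bound_of_continuous hdc
  have hδ : 0 < min (c - a) (b - d) := lt_min (by linarith) (by linarith)
  set δ := min (c - a) (b - d) with hδdef
  have hδ1 : δ ≤ c - a := min_le_left _ _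
  have hδ2 : δ ≤ b - d := min_le_right _ _
  -- Radii at most δ/2 keep the mollified supports in [c - δ/2, d + δ/2], inside (a, b).
  let φ : ℕ → ContDiffBump (0 : ℝ) := fun k =>
    ⟨δ / 4 / (k + 1), δ / 2 / (k + 1), by positivity, by gcongr; linarith⟩
  have hφ : ∀ k, (φ k).rOut ≤ δ / 2 := fun k =>
    div_le_self (by positivity) (by linarith [Nat.cast_nonneg (α := ℝ) k])
  have hφ0 : Filter.Tendsto (fun k => (φ k).rOut) Filter.atTop (nhds 0) := by
    have := (tendsto_one_div_add_atTop_nhds_zero_nat (𝕜 := ℝ)).const_mul (δ / 2)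
    simpa [φ, div_eq_mul_inv] using this
  let L := ContinuousLinearMap.lsmul ℝ ℝ (E := ℝ)
  let χ : ℕ → ℝ → ℝ := fun k => convolution ((φ k).normed volume) w L volume
  have hder : ∀ k x, HasDerivAt (χ k)
      (convolution ((φ k).normed volume) (deriv w) L volume x) x := fun k x =>
    hcs.hasDerivAt_convolution_right L
      ((φ k).continuous_normed.locallyIntegrable) hw x
  have hder' : ∀ k, deriv (χ k) = convolution ((φ k).normed volume) (deriv w) L volume :=
    fun k => funext fun x => (hder k x).deriv
  -- A mollification differs from g by at most the oscillation 2M, and |g| ≤ M: hence 3M.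
  have hbd : ∀ (g : ℝ → ℝ) (M : ℝ), Continuous g → (∀ x, ‖g x‖ ≤ M) → ∀ k x,
      |convolution ((φ k).normed volume) g L volume x| ≤ 3 * M := by
    intro g M hg hM k x
    have h1 := (φ k).dist_normed_convolution_le (μ := volume) (x₀ := x) (ε := 2 * M)
      hg.aestronglyMeasurable fun y _ => by
        rw [dist_eq_norm]
        linarith [norm_sub_le (g y) (g x), hM y, hM x]
    have h2 := hM x
    rw [dist_eq_norm, Real.norm_eq_abs] at h1
    rw [Real.norm_eq_abs] at h2
    have h3 := abs_add_le (convolution ((φ k).normed volume) g L volume x - g x) (g x)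
    rw [sub_add_cancel] at h3
    linarith
  refine ⟨χ, max (3 * M₁) (3 * M₂), fun k => ⟨?_, c - δ / 2, d + δ / 2, ?_, ?_, fun x hx => ?_⟩,
    fun k x => (hbd w M₁ hwc hM₁ k x).trans (le_max_left _ _), fun k x => ?_, fun x => ?_,
    fun x => ?_⟩
  · exact (φ k).hasCompactSupport_normed.contDiff_convolution_left _ (φ k).contDiff_normed
      hwc.locallyIntegrable
  · linarith
  · linarith
  · have hz : ∀ y ∈ Metric.ball x (φ k).rOut, w y = 0 := fun y hy => hw0 y fun hy' => by
      rw [Metric.mem_ball, Real.dist_eq, abs_lt] at hy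
      have := hφ k
      exact hx ⟨by linarith [hy'.1], by linarith [hy'.2]⟩
    have hx0 : w x = 0 := hz x (Metric.mem_ball_self (φ k).rOut_pos)
    have h1 := (φ k).dist_normed_convolution_le (μ := volume) (x₀ := x) (ε := 0) (g := w)
      hwc.aestronglyMeasurable fun y hy => by rw [hz y hy, hx0, dist_self]
    rw [hx0] at h1
    exact dist_le_zero.1 h1
  · rw [hder']
    exact (hbd _ M₂ hdc hM₂ k x).trans (le_max_right _ _)
  · exact ContDiffBump.convolution_tendsto_right_of_continuous hφ0 hwc x
  · simp only [hder']
    exact ContDiffBump.convolution_tendsto_right_of_continuous hφ0 hdc x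

/-! ### Calculus of radial functions. -/

section Radial

variable {n : ℕ} {a b : ℝ} {χ : ℝ → ℝ}

theorem norm_eventually_notMem {c d : ℝ} {x : EuclideanSpace ℝ (Fin n)} (hx : ‖x‖ ∉ Icc c d) :
    ∀ᶠ y in nhds x, ‖y‖ ∉ Icc c d :=
  continuous_norm.continuousAt.eventually (isClosed_Icc.isOpen_compl.mem_nhds hx)

/-- Smooth radial functions supported away from the origin, times smooth functions, are test
functions in the ball. -/
theorem TestOn.isTestFunction_mul {R : ℝ} (h : TestOn a b χ) (ha : 0 ≤ a) (hb : b ≤ R)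
    {p : EuclideanSpace ℝ (Fin n) → ℝ} (hp : ContDiff ℝ ∞ p) :
    IsTestFunction (Metric.ball (0 : EuclideanSpace ℝ (Fin n)) R) (fun x => χ ‖x‖ * p x) := by
  obtain ⟨c, d, hc, hd, h0⟩ := h.supp
  have hz : ∀ x : EuclideanSpace ℝ (Fin n), x ∉ Metric.closedBall 0 d → χ ‖x‖ * p x = 0 :=
    fun x hx => by
      rw [h0, zero_mul]
      intro hx'
      exact hx (by simpa using hx'.2)
  refine ⟨?_, HasCompactSupport.intro (isCompact_closedBall 0 d) hz, ?_⟩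
  · refine ContDiff.mul (contDiff_iff_contDiffAt.2 fun x => ?_) hp
    by_cases hx : x = 0
    · subst hx
      have hx' : ‖(0 : EuclideanSpace ℝ (Fin n))‖ ∉ Icc c d := fun hx' => by
        rw [norm_zero] at hx'; linarith [hx'.1]
      refine contDiffAt_const (c := (0 : ℝ)).congr_of_eventuallyEq ?_
      filter_upwards [norm_eventually_notMem hx'] with y hy using h0 _ hy
    · exact h.smooth.contDiffAt.comp x (contDiffAt_norm ℝ hx)
  · refine (closure_minimal (t := Metric.closedBall 0 d) (fun x hx => ?_)
      Metric.isClosed_closedBall).trans (Metric.closedBall_subset_ball (hd.trans_le hb))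
    by_contra hx'
    exact hx (hz x hx')

theorem TestOn.isTestFunction {R : ℝ} (h : TestOn a b χ) (ha : 0 ≤ a) (hb : b ≤ R) :
    IsTestFunction (Metric.ball (0 : EuclideanSpace ℝ (Fin n)) R) (fun x => χ ‖x‖) := by
  simpa using h.isTestFunction_mul (n := n) ha hb (p := fun _ => 1) contDiff_const

theorem hasFDerivAt_norm {x : EuclideanSpace ℝ (Fin n)} (hx : x ≠ 0) :
    HasFDerivAt (fun y : EuclideanSpace ℝ (Fin n) => ‖y‖) (‖x‖⁻¹ • innerSL ℝ x) x := by
  have h1 := (hasStrictFDerivAt_norm_sq x).hasFDerivAt.sqrt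
    (pow_ne_zero 2 (norm_ne_zero_iff.2 hx))
  simp only [Real.sqrt_sq (norm_nonneg _)] at h1
  have h2 : (1 / (2 * ‖x‖)) • 2 • innerSL ℝ x = ‖x‖⁻¹ • innerSL ℝ x := by
    rw [two_smul, ← two_smul ℝ, smul_smul]
    congr 1
    have := norm_ne_zero_iff.2 hx
    field_simp
  rwa [h2] at h1

theorem hasFDerivAt_comp_norm {G : ℝ → ℝ} {G' : ℝ} {x : EuclideanSpace ℝ (Fin n)} (hx : x ≠ 0)
    (hG : HasDerivAt G G' ‖x‖) :
    HasFDerivAt (fun y : EuclideanSpace ℝ (Fin n) => G ‖y‖) ((G' * ‖x‖⁻¹) • innerSL ℝ x) x := by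
  have := hG.comp_hasFDerivAt x (hasFDerivAt_norm hx)
  rwa [smul_smul] at this

theorem TestOn.hasFDerivAt_comp_norm (h : TestOn a b χ) (ha : 0 ≤ a)
    (x : EuclideanSpace ℝ (Fin n)) :
    HasFDerivAt (fun y : EuclideanSpace ℝ (Fin n) => χ ‖y‖)
      ((_root_.deriv χ ‖x‖ * ‖x‖⁻¹) • innerSL ℝ x) x := by
  by_cases hx : x = 0
  · subst hx
    obtain ⟨c, d, hc, hd, h0⟩ := h.supp
    have hx' : ‖(0 : EuclideanSpace ℝ (Fin n))‖ ∉ Icc c d := fun hx' => by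
      rw [norm_zero] at hx'; linarith [hx'.1]
    have : (fun y : EuclideanSpace ℝ (Fin n) => χ ‖y‖) =ᶠ[nhds 0] fun _ => 0 := by
      filter_upwards [norm_eventually_notMem hx'] with y hy using h0 _ hy
    simpa using (hasFDerivAt_const (0 : ℝ) (0 : EuclideanSpace ℝ (Fin n))).congr_of_eventuallyEq
      this
  · exact MeanCurvature.hasFDerivAt_comp_norm hx (h.hasDerivAt _)

theorem gradient_apply (φ : EuclideanSpace ℝ (Fin n) → ℝ) (x : EuclideanSpace ℝ (Fin n))
    (i : Fin n) : gradient φ x i = fderiv ℝ φ x (EuclideanSpace.single i 1) := by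
  have : inner ℝ (gradient φ x) (EuclideanSpace.single i (1 : ℝ)) = gradient φ x i := by
    rw [EuclideanSpace.inner_single_right]; simp
  rw [← this, gradient, InnerProductSpace.toDual_symm_apply]

theorem TestOn.gradient_comp_norm (h : TestOn a b χ) (ha : 0 ≤ a)
    (x : EuclideanSpace ℝ (Fin n)) :
    gradient (fun y : EuclideanSpace ℝ (Fin n) => χ ‖y‖) x
      = (_root_.deriv χ ‖x‖ * ‖x‖⁻¹) • x := by
  ext i
  rw [gradient_apply, (h.hasFDerivAt_comp_norm ha x).fderiv]
  simp [EuclideanSpace.inner_single_right]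

theorem TestOn.gradient_mul (h : TestOn a b χ) (ha : 0 ≤ a) {p : EuclideanSpace ℝ (Fin n) → ℝ}
    {p' : EuclideanSpace ℝ (Fin n) →L[ℝ] ℝ} {x : EuclideanSpace ℝ (Fin n)}
    (hp : HasFDerivAt p p' x) (j : Fin n) :
    gradient (fun y : EuclideanSpace ℝ (Fin n) => χ ‖y‖ * p y) x j
      = _root_.deriv χ ‖x‖ * ‖x‖⁻¹ * x j * p x + χ ‖x‖ * p' (EuclideanSpace.single j 1) := by
  have h1 : HasFDerivAt (fun y : EuclideanSpace ℝ (Fin n) => χ ‖y‖ * p y) _ x :=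
    (h.hasFDerivAt_comp_norm ha x).mul hp
  rw [gradient_apply, h1.fderiv]
  simp [EuclideanSpace.inner_single_right]
  ring

theorem sum_sq_eq_norm_sq (x : EuclideanSpace ℝ (Fin n)) : ∑ i, x i * x i = ‖x‖ * ‖x‖ := by
  rw [← sq, EuclideanSpace.real_norm_sq_eq]
  simp [sq]

theorem hasFDerivAt_coord (i : Fin n) (x : EuclideanSpace ℝ (Fin n)) :
    HasFDerivAt (fun y : EuclideanSpace ℝ (Fin n) => y i)
      (EuclideanSpace.proj i : EuclideanSpace ℝ (Fin n) →L[ℝ] ℝ) x :=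
  (EuclideanSpace.proj i : EuclideanSpace ℝ (Fin n) →L[ℝ] ℝ).hasFDerivAt

/-- `div (χ(|x|) x) = |x| χ'(|x|) + n χ(|x|)`. -/
theorem TestOn.sum_gradient_coord (h : TestOn a b χ) (ha : 0 ≤ a)
    (x : EuclideanSpace ℝ (Fin n)) :
    ∑ i, gradient (fun y : EuclideanSpace ℝ (Fin n) => χ ‖y‖ * y i) x i
      = ‖x‖ * _root_.deriv χ ‖x‖ + n * χ ‖x‖ := by
  simp_rw [h.gradient_mul ha (hasFDerivAt_coord _ x)]
  have : ∀ i, _root_.deriv χ ‖x‖ * ‖x‖⁻¹ * x i * x i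
      = _root_.deriv χ ‖x‖ * ‖x‖⁻¹ * (x i * x i) := fun i => by ring
  simp_rw [Finset.sum_add_distrib, this]
  rw [← Finset.mul_sum, sum_sq_eq_norm_sq]
  simp
  by_cases hx : ‖x‖ = 0
  · simp [hx]
  · field_simp

/-- `div (χ(|x|) xᵢ x) = (|x| χ'(|x|) + (n + 1) χ(|x|)) xᵢ`. -/
theorem TestOn.sum_gradient_coord_mul (h : TestOn a b χ) (ha : 0 ≤ a)
    (x : EuclideanSpace ℝ (Fin n)) (i : Fin n) :
    ∑ j, gradient (fun y : EuclideanSpace ℝ (Fin n) => χ ‖y‖ * (y i * y j)) x j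
      = (‖x‖ * _root_.deriv χ ‖x‖ + (n + 1) * χ ‖x‖) * x i := by
  have hp : ∀ j, HasFDerivAt (fun y : EuclideanSpace ℝ (Fin n) => y i * y j)
      (x i • (EuclideanSpace.proj j : EuclideanSpace ℝ (Fin n) →L[ℝ] ℝ)
        + x j • (EuclideanSpace.proj i : EuclideanSpace ℝ (Fin n) →L[ℝ] ℝ)) x := fun j =>
    (hasFDerivAt_coord i x).mul (hasFDerivAt_coord j x)
  simp_rw [fun j => h.gradient_mul ha (hp j) j]
  have : ∀ j, _root_.deriv χ ‖x‖ * ‖x‖⁻¹ * x j * (x i * x j)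
      = _root_.deriv χ ‖x‖ * ‖x‖⁻¹ * x i * (x j * x j) := fun i => by ring
  simp_rw [Finset.sum_add_distrib, this]
  rw [← Finset.mul_sum, sum_sq_eq_norm_sq]
  simp [PiLp.single_apply, mul_add, Finset.sum_add_distrib]
  by_cases hx : ‖x‖ = 0
  · have hx0 : x = 0 := norm_eq_zero.1 hx
    simp [hx0]
  · field_simp

end Radial

/-! ### Polar coordinates. -/

section Polar

variable {n : ℕ}

/-- The area of the unit sphere of `ℝⁿ`. -/
noncomputable def sphereArea (n : ℕ) : ℝ :=
  n * volume.real (Metric.ball (0 : EuclideanSpace ℝ (Fin n)) 1)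

theorem sphereArea_pos (hn : 0 < n) : 0 < sphereArea n := by
  refine mul_pos (by exact_mod_cast hn) ?_
  exact ENNReal.toReal_pos (Metric.measure_ball_pos _ _ one_pos).ne' measure_ball_lt_top.ne

theorem nontrivial_euclideanSpace (hn : 0 < n) : Nontrivial (EuclideanSpace ℝ (Fin n)) := by
  apply Module.nontrivial_of_finrank_pos (R := ℝ)
  simpa using hn

theorem integral_norm_eq (hn : 0 < n) (q : ℝ → ℝ) :
    ∫ x : EuclideanSpace ℝ (Fin n), q ‖x‖ = sphereArea n * ∫ r in Ioi 0, r ^ (n - 1) * q r := by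
  have := nontrivial_euclideanSpace hn
  rw [integral_fun_norm_addHaar, finrank_euclideanSpace_fin, sphereArea]
  simp [mul_assoc]

theorem setIntegral_ball_norm_eq (hn : 0 < n) {R : ℝ} (q : ℝ → ℝ) :
    ∫ x in Metric.ball (0 : EuclideanSpace ℝ (Fin n)) R, q ‖x‖
      = sphereArea n * ∫ r in Ioo 0 R, r ^ (n - 1) * q r := by
  rw [← integral_indicator measurableSet_ball]
  have h1 : ∀ x : EuclideanSpace ℝ (Fin n),
      (Metric.ball (0 : EuclideanSpace ℝ (Fin n)) R).indicator (fun x => q ‖x‖) x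
        = (Iio R).indicator q ‖x‖ := fun x => by simp [indicator]
  simp_rw [h1]
  rw [integral_norm_eq hn, ← integral_indicator measurableSet_Ioo,
    ← integral_indicator measurableSet_Ioi]
  congr 2 with r
  by_cases h0 : 0 < r <;> by_cases hR : r < R <;> simp [h0, hR]

/-- Polar coordinates for a radial function supported in an annulus. -/
theorem setIntegral_ball_norm_eq_of_support (hn : 0 < n) {a b R : ℝ} (ha : 0 ≤ a) (hb : b ≤ R)
    {q : ℝ → ℝ} (hq : ∀ r, r ∉ Ioo a b → q r = 0) :
    ∫ x in Metric.ball (0 : EuclideanSpace ℝ (Fin n)) R, q ‖x‖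
      = sphereArea n * ∫ r, r ^ (n - 1) * q r := by
  rw [setIntegral_ball_norm_eq hn, setIntegral_eq_integral_of_forall_compl_eq_zero]
  intro r hr
  rw [hq r fun h => hr ⟨ha.trans_lt h.1, h.2.trans_le hb⟩, mul_zero]

/-- In polar coordinates the indicator of the exceptional radii integrates to zero. -/
theorem ae_norm_of_ae (hn : 0 < n) {p : ℝ → Prop} (hp : ∀ᵐ r, p r) :
    ∀ᵐ x : EuclideanSpace ℝ (Fin n), p ‖x‖ := by
  have := nontrivial_euclideanSpace hn
  let q : ℝ → ℝ := indicator {r | ¬ p r} 1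
  have hq : ∀ᵐ r : ℝ, r ^ (n - 1) * q r = 0 := by
    filter_upwards [hp] with r hr
    simp [q, hr]
  have hint : Integrable (fun x : EuclideanSpace ℝ (Fin n) => q ‖x‖) := by
    rw [integrable_fun_norm_addHaar, finrank_euclideanSpace_fin]
    refine (integrable_zero ℝ ℝ _).congr ?_
    filter_upwards [ae_restrict_of_ae hq] with r hr
    simpa using hr.symm
  have h0 : ∫ x : EuclideanSpace ℝ (Fin n), q ‖x‖ = 0 := by
    rw [integral_norm_eq hn, integral_congr_ae (ae_restrict_of_ae hq)]
    simp
  rw [integral_eq_zero_iff_of_nonneg (fun x => indicator_nonneg (by simp) _) hint] at h0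
  filter_upwards [h0] with x hx
  by_contra h
  simp [h] at hx

end Polar

/-! ### Integrability of pairings with test functions. -/

theorem integrable_mul_of_locallyIntegrableOn {n : ℕ} {Ω : Set (EuclideanSpace ℝ (Fin n))}
    {u ψ : EuclideanSpace ℝ (Fin n) → ℝ} (hu : LocallyIntegrableOn u Ω volume)
    (hψ : Continuous ψ) (hc : HasCompactSupport ψ) (hs : tsupport ψ ⊆ Ω) :
    Integrable (fun x => u x * ψ x) := by
  have h1 : IntegrableOn (fun x => u x * ψ x) (tsupport ψ) := by
    obtain ⟨C, hC⟩ := hc.exists_bound_of_continuous hψ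
    exact (hu.integrableOn_compact_subset hs hc.isCompact).mul_bdd (c := C)
      hψ.aestronglyMeasurable (ae_of_all _ hC)
  refine (integrableOn_iff_integrable_of_support_subset fun x hx => ?_).1 h1
  by_contra hx'
  exact hx (by simp [image_eq_zero_of_notMem_tsupport hx'])

theorem IsTestFunction.integrable_mul {n : ℕ} {Ω : Set (EuclideanSpace ℝ (Fin n))}
    {u φ : EuclideanSpace ℝ (Fin n) → ℝ} (hφ : IsTestFunction Ω φ)
    (hu : LocallyIntegrableOn u Ω volume) : Integrable (fun x => u x * φ x) :=
  integrable_mul_of_locallyIntegrableOn hu hφ.smooth.continuous hφ.compact hφ.subset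

theorem IsTestFunction.integrable_mul_gradient {n : ℕ} {Ω : Set (EuclideanSpace ℝ (Fin n))}
    {u φ : EuclideanSpace ℝ (Fin n) → ℝ} (hφ : IsTestFunction Ω φ)
    (hu : LocallyIntegrableOn u Ω volume) (i : Fin n) :
    Integrable (fun x => u x * gradient φ x i) := by
  simp_rw [gradient_apply]
  refine integrable_mul_of_locallyIntegrableOn hu ?_ ?_ ?_
  · exact (hφ.smooth.continuous_fderiv (by simp)).clm_apply continuous_const
  · exact hφ.compact.fderiv_apply ℝ _
  · exact (tsupport_fderiv_apply_subset ℝ _).trans hφ.subset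

theorem contDiff_coord {n : ℕ} (i : Fin n) :
    ContDiff ℝ ∞ (fun y : EuclideanSpace ℝ (Fin n) => y i) :=
  (EuclideanSpace.proj i : EuclideanSpace ℝ (Fin n) →L[ℝ] ℝ).contDiff

theorem locallyIntegrableOn_coord {n : ℕ} {Ω : Set (EuclideanSpace ℝ (Fin n))}
    {V : EuclideanSpace ℝ (Fin n) → EuclideanSpace ℝ (Fin n)}
    (hV : LocallyIntegrableOn V Ω volume) (i : Fin n) :
    LocallyIntegrableOn (fun x => V x i) Ω volume := fun x hx => by
  obtain ⟨s, hs, hi⟩ := hV x hx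
  exact ⟨s, hs, (EuclideanSpace.proj i : EuclideanSpace ℝ (Fin n) →L[ℝ] ℝ).integrable_comp hi⟩

/-! ### Second weak derivatives in the radial direction. -/

section SecondOrder

variable {n : ℕ} {a b R : ℝ} {u : EuclideanSpace ℝ (Fin n) → ℝ}
  {Du : EuclideanSpace ℝ (Fin n) → EuclideanSpace ℝ (Fin n)}
  {D2u : Fin n → EuclideanSpace ℝ (Fin n) → EuclideanSpace ℝ (Fin n)} {χ : ℝ → ℝ}

/-- The weak gradient tested with the radial field `χ(|x|) x`. -/
theorem HasWeakGradient.integral_radial (hu : HasWeakGradient (Metric.ball 0 R) u Du)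
    (ha : 0 ≤ a) (hb : b ≤ R) (hχ : TestOn a b χ) :
    ∫ x in Metric.ball 0 R, u x * (‖x‖ * deriv χ ‖x‖ + n * χ ‖x‖)
      = -∑ i, ∫ x in Metric.ball 0 R, Du x i * (χ ‖x‖ * x i) := by
  have ht : ∀ i : Fin n, IsTestFunction (Metric.ball (0 : EuclideanSpace ℝ (Fin n)) R)
    (fun x => χ ‖x‖ * x i) := fun i => hχ.isTestFunction_mul ha hb (contDiff_coord i)
  simp_rw [← hχ.sum_gradient_coord ha, Finset.mul_sum]
  rw [integral_finsetSum _ fun i _ =>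
    ((ht i).integrable_mul_gradient hu.locInt i).integrableOn, ← Finset.sum_neg_distrib]
  exact Finset.sum_congr rfl fun i _ => hu.integral_eq _ (ht i) i

/-- The weak gradient tested with the field `χ(|x|) xᵢ x`. -/
theorem HasWeakGradient.integral_coord_radial (hu : HasWeakGradient (Metric.ball 0 R) u Du)
    (ha : 0 ≤ a) (hb : b ≤ R) (hχ : TestOn a b χ) (i : Fin n) :
    ∫ x in Metric.ball 0 R, u x * ((‖x‖ * deriv χ ‖x‖ + (n + 1) * χ ‖x‖) * x i)
      = -∑ j, ∫ x in Metric.ball 0 R, Du x j * (χ ‖x‖ * (x i * x j)) := by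
  have ht : ∀ j : Fin n, IsTestFunction (Metric.ball (0 : EuclideanSpace ℝ (Fin n)) R)
    (fun x => χ ‖x‖ * (x i * x j)) := fun j =>
      hχ.isTestFunction_mul ha hb ((contDiff_coord i).mul (contDiff_coord j))
  simp_rw [← hχ.sum_gradient_coord_mul ha, Finset.mul_sum]
  rw [integral_finsetSum _ fun j _ =>
    ((ht j).integrable_mul_gradient hu.locInt j).integrableOn, ← Finset.sum_neg_distrib]
  exact Finset.sum_congr rfl fun j _ => hu.integral_eq _ (ht j) j

theorem TestOn.euler (hχ : TestOn a b χ) (k : ℝ) :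
    TestOn a b (fun r => r * _root_.deriv χ r + k * χ r) :=
  (hχ.deriv.mul_left (p := fun r => r) fun _ _ => contDiffAt_id).add (hχ.const_mul k)

/-- The field χ(|x|) xᵢ x has divergence κ(|x|) xᵢ. So testing u with κ(|x|) x and then each ∂ᵢu
with χ(|x|) xᵢ x moves both derivatives onto u, and only the radial second derivative appears. -/
theorem integral_radial_second_order (hu : HasWeakGradient (Metric.ball 0 R) u Du)
    (h2 : ∀ i, HasWeakGradient (Metric.ball 0 R) (fun x => Du x i) (D2u i))
    (ha : 0 ≤ a) (hb : b ≤ R) (hχ : TestOn a b χ) {κ : ℝ → ℝ}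
    (hκ : κ = fun r => r * deriv χ r + (n + 1) * χ r) :
    ∫ x in Metric.ball 0 R, u x * (‖x‖ * deriv κ ‖x‖ + n * κ ‖x‖)
      = ∫ x in Metric.ball 0 R, (∑ i, ∑ j, D2u i x j * (x i * x j)) * χ ‖x‖ := by
  have hκt : TestOn a b κ := hκ ▸ hχ.euler _
  have hint : ∀ i j : Fin n, IntegrableOn (fun x => D2u i x j * (χ ‖x‖ * (x i * x j)))
      (Metric.ball 0 R) := fun i j => ((hχ.isTestFunction_mul ha hb
        ((contDiff_coord i).mul (contDiff_coord j))).integrable_mul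
          (locallyIntegrableOn_coord (h2 i).locInt_grad j)).integrableOn
  rw [hu.integral_radial ha hb hκt, hκ]
  simp_rw [fun i => (h2 i).integral_coord_radial ha hb hχ i]
  rw [Finset.sum_neg_distrib, neg_neg]
  simp_rw [Finset.sum_mul]
  have hr : ∀ (x : EuclideanSpace ℝ (Fin n)) (i j : Fin n),
      D2u i x j * (x i * x j) * χ ‖x‖ = D2u i x j * (χ ‖x‖ * (x i * x j)) :=
    fun x i j => by ring
  simp_rw [hr]
  rw [integral_finsetSum _ fun i _ => integrable_finsetSum _ fun j _ => hint i j]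
  exact Finset.sum_congr rfl fun i _ => (integral_finsetSum _ fun j _ => hint i j).symm

end SecondOrder

/-! ### Radial averages and their primitives. -/

section Fubini

variable {n : ℕ} {F : EuclideanSpace ℝ (Fin n) → ℝ}

/-- Spheres are null sets. This continuity is what makes the second primitive C^1. -/
theorem continuous_setIntegral_ball (hn : 0 < n) (hF : Integrable F) :
    Continuous fun s : ℝ => ∫ x in Metric.ball (0 : EuclideanSpace ℝ (Fin n)) s, F x := by
  have := nontrivial_euclideanSpace hn
  have h1 : (fun s : ℝ => ∫ x in Metric.ball (0 : EuclideanSpace ℝ (Fin n)) s, F x)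
      = fun s => ∫ x, (Metric.ball (0 : EuclideanSpace ℝ (Fin n)) s).indicator F x :=
    funext fun s => (integral_indicator measurableSet_ball).symm
  rw [h1, continuous_iff_continuousAt]
  intro s
  refine continuousAt_of_dominated (bound := fun x => ‖F x‖)
    (.of_forall fun t => hF.aestronglyMeasurable.indicator measurableSet_ball)
    (.of_forall fun t => ae_of_all _ fun x => norm_indicator_le_norm_self _ _) hF.norm ?_
  have h2 : ∀ᵐ x : EuclideanSpace ℝ (Fin n), x ∉ Metric.sphere (0 : EuclideanSpace ℝ (Fin n)) s :=
    measure_eq_zero_iff_ae_notMem.1 (Measure.addHaar_sphere _ _ _)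
  filter_upwards [h2] with x hx
  rw [mem_sphere_zero_iff_norm] at hx
  rcases lt_or_gt_of_ne hx with h | h
  · refine (continuousAt_const (y := F x)).congr ?_
    filter_upwards [lt_mem_nhds h] with t ht
    simp [ht]
  · refine (continuousAt_const (y := (0 : ℝ))).congr ?_
    filter_upwards [gt_mem_nhds h] with t ht
    simp [ht.le]

/-- Insert ψ(t) = -∫_t^∞ ψ' and exchange the integrals: an integration by parts in the radius that
needs no density for the radial average. -/
theorem integral_mul_comp_norm {a b : ℝ} {ψ : ℝ → ℝ} (hF : Integrable F) (hψ : TestOn a b ψ) :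
    ∫ x, F x * ψ ‖x‖ = -∫ s, (∫ x in Metric.ball 0 s, F x) * deriv ψ s := by
  have h1 : ∀ t, ψ t = -∫ s, (Ioi t).indicator (deriv ψ) s := fun t => by
    rw [integral_indicator measurableSet_Ioi,
      hψ.hasCompactSupport.integral_Ioi_deriv_eq (hψ.smooth.of_le (by simp)), neg_neg]
  have hm : MeasurableSet {p : EuclideanSpace ℝ (Fin n) × ℝ | ‖p.1‖ < p.2} :=
    measurableSet_lt (by fun_prop) (by fun_prop)
  have hint : Integrable (Function.uncurry fun (x : EuclideanSpace ℝ (Fin n)) (s : ℝ) =>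
      F x * (Ioi ‖x‖).indicator (deriv ψ) s) (volume.prod volume) := by
    refine ((hF.mul_prod hψ.deriv.integrable).indicator hm).congr (ae_of_all _ fun p => ?_)
    by_cases hp : ‖p.1‖ < p.2 <;> simp [Function.uncurry, hp]
  calc ∫ x, F x * ψ ‖x‖ = -∫ x, ∫ s, F x * (Ioi ‖x‖).indicator (deriv ψ) s := by
        rw [← integral_neg]
        congr with x
        rw [integral_const_mul, h1]
        ring
    _ = -∫ s, ∫ x, F x * (Ioi ‖x‖).indicator (deriv ψ) s := by
        rw [integral_integral_swap hint]
    _ = _ := by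
        congr 2 with s
        rw [← integral_indicator measurableSet_ball, ← integral_mul_const]
        congr with x
        by_cases hx : ‖x‖ < s <;> simp [hx]

/-- The radial averages of an integrable function have a `C^1` second primitive. -/
theorem exists_second_primitive (hn : 0 < n) (hF : Integrable F) :
    ∃ H : ℝ → ℝ, ContDiff ℝ 1 H ∧ ∀ (a b : ℝ) (ψ : ℝ → ℝ), TestOn a b ψ →
      ∫ x, F x * ψ ‖x‖ = ∫ r, H r * deriv (deriv ψ) r := by
  set Φ : ℝ → ℝ := fun s => ∫ x in Metric.ball (0 : EuclideanSpace ℝ (Fin n)) s, F x with hΦ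
  have hΦc : Continuous Φ := continuous_setIntegral_ball hn hF
  obtain ⟨hH, hd⟩ := contDiff_primitive hΦc 0
  refine ⟨_, hH, fun a b ψ hψ => ?_⟩
  have hi : ∀ (p q : ℝ → ℝ), Continuous p → TestOn a b q → Integrable (fun r => p r * q r) :=
    fun p q hp hq => hq.integrable_mul (hp.integrableOn_Icc.mono_set Ioo_subset_Icc_self)
  rw [integral_mul_comp_norm hF hψ, integral_mul_deriv_eq_deriv_mul_of_integrable
    (fun x _ => hd x) (fun x _ => hψ.deriv.hasDerivAt x) (hi _ _ hH.continuous hψ.deriv.deriv)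
    (hi _ _ hΦc hψ.deriv) (hi _ _ hH.continuous hψ.deriv)]

end Fubini

/-! ### The profile is C^1 away from the origin. -/

/-- Polar coordinates give integrability against r^(n-1), and this weight is bounded below where r >
a > 0. -/
theorem integrableOn_profile {n : ℕ} (hn : 0 < n) {a b R : ℝ} (ha : 0 < a) (hb : b < R)
    {u : EuclideanSpace ℝ (Fin n) → ℝ} (hu : LocallyIntegrableOn u (Metric.ball 0 R) volume)
    {g : ℝ → ℝ}
    (hg : ∀ᵐ x ∂(volume.restrict (Metric.ball (0 : EuclideanSpace ℝ (Fin n)) R)), u x = g ‖x‖) :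
    IntegrableOn g (Ioo a b) := by
  have := nontrivial_euclideanSpace hn
  have h1 : IntegrableOn u (Metric.ball 0 b) :=
    (hu.integrableOn_compact_subset (Metric.closedBall_subset_ball hb)
      (isCompact_closedBall 0 b)).mono_set Metric.ball_subset_closedBall
  have h2 : IntegrableOn (fun x : EuclideanSpace ℝ (Fin n) => g ‖x‖) (Metric.ball 0 b) :=
    h1.congr_fun_ae (ae_restrict_of_ae_restrict_of_subset (Metric.ball_subset_ball hb.le) hg)
  rw [integrableOn_fun_norm_addHaar, finrank_euclideanSpace_fin] at h2
  have h3 := h2.mono_set (Ioo_subset_Ioo_left ha.le)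
  have h4 : IntegrableOn (fun r => (r ^ (n - 1))⁻¹ * (r ^ (n - 1) • g r)) (Ioo a b) := by
    refine h3.bdd_mul (c := (a ^ (n - 1))⁻¹) (by fun_prop) ?_
    filter_upwards [ae_restrict_mem measurableSet_Ioo] with r hr
    have : 0 < r := ha.trans hr.1
    rw [Real.norm_eq_abs, abs_of_nonneg (by positivity)]
    have := hr.1.le
    gcongr
  refine h4.congr_fun (fun r hr => ?_) measurableSet_Ioo
  have : r ≠ 0 := (ha.trans hr.1).ne'
  simp [this]

/-- A radial function of class `W^{2,1}` agrees in each annulus with a `C^1` function of the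
radius. -/
theorem exists_contDiff_profile {n : ℕ} (hn : 0 < n) {a b R : ℝ} (ha : 0 < a) (hab : a < b)
    (hb : b < R) {u : EuclideanSpace ℝ (Fin n) → ℝ}
    (hu : MemSobolevLoc (Metric.ball 0 R) 2 u) (hrad : IsRadialOn (Metric.ball 0 R) u) :
    ∃ G : ℝ → ℝ, ContDiff ℝ 1 G ∧ ∀ᵐ x, ‖x‖ ∈ Ioo a b → u x = G ‖x‖ := by
  obtain ⟨Du, hDu, h2⟩ := hu
  choose D2u hD2u _ using h2
  obtain ⟨g, hg⟩ := hrad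
  have hgi : IntegrableOn g (Ioo a b) := integrableOn_profile hn ha hb hDu.locInt hg
  set F : EuclideanSpace ℝ (Fin n) → ℝ := fun x => ∑ i, ∑ j, D2u i x j * (x i * x j) with hFdef
  have hA : MeasurableSet {x : EuclideanSpace ℝ (Fin n) | ‖x‖ ∈ Ioo a b} :=
    measurableSet_Ioo.preimage measurable_norm
  -- F/|x|² is the second radial derivative; the remaining |x|^(1-n) cancels the Jacobian of polar
  -- coordinates.
  have hF : Integrable ({x : EuclideanSpace ℝ (Fin n) | ‖x‖ ∈ Ioo a b}.indicator
      fun x => F x * (‖x‖ ^ (n + 1))⁻¹) := by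
    rw [integrable_indicator_iff hA]
    have hFi : IntegrableOn F {x : EuclideanSpace ℝ (Fin n) | ‖x‖ ∈ Ioo a b} := by
      refine integrable_finsetSum _ fun i _ => integrable_finsetSum _ fun j _ => ?_
      have h1 : IntegrableOn (fun x => D2u i x j) {x | ‖x‖ ∈ Ioo a b} :=
        ((locallyIntegrableOn_coord (hD2u i).locInt_grad j).integrableOn_compact_subset
          (Metric.closedBall_subset_ball hb) (isCompact_closedBall 0 b)).mono_set fun x hx => by
            simpa using hx.2.le
      refine h1.mul_bdd (c := b * b) (by fun_prop) ?_
      filter_upwards [ae_restrict_mem hA] with x hx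
      rw [norm_mul]
      exact mul_le_mul ((PiLp.norm_apply_le x i).trans hx.2.le)
        ((PiLp.norm_apply_le x j).trans hx.2.le) (norm_nonneg _) (ha.trans hab).le
    refine hFi.mul_bdd (c := (a ^ (n + 1))⁻¹) (by fun_prop) ?_
    filter_upwards [ae_restrict_mem hA] with x hx
    have hx' : a < ‖x‖ := hx.1
    rw [Real.norm_eq_abs, abs_of_nonneg (by positivity)]
    gcongr
  obtain ⟨H, hH, hHψ⟩ := exists_second_primitive hn hF
  have hS := sphereArea_pos hn
  have hHi : IntegrableOn H (Ioo a b) := hH.continuous.integrableOn_Icc.mono_set Ioo_subset_Icc_self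
  have key : ∀ ψ, TestOn a b ψ →
      ∫ r, (sphereArea n * g r - H r) * deriv (deriv ψ) r = 0 := by
    intro ψ hψ
    -- This power gives ψ' = r^n κ and ψ'' = r^(n-1)(rκ' + nκ), the polar form of the second-order
    -- operator, so that both sides test against ψ''.
    set χ : ℝ → ℝ := fun r => (r ^ (n + 1))⁻¹ * ψ r with hχdef
    have hχ : TestOn a b χ := hψ.mul_left fun r hr =>
      (contDiffAt_id.pow _).inv (pow_ne_zero _ (ha.trans hr.1).ne')
    set κ : ℝ → ℝ := fun r => r * deriv χ r + (n + 1) * χ r with hκdef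
    have hκ : TestOn a b κ := hχ.euler _
    have hψχ : ψ = fun r => r ^ (n + 1) * χ r := by
      funext r
      by_cases hr : r ∈ Ioo a b
      · have : r ≠ 0 := (ha.trans hr.1).ne'
        simp [χ, this]
      · simp [hψ.eq_zero hr, hχ.eq_zero hr]
    have hd1 : deriv ψ = fun r => r ^ n * κ r := by
      funext r
      have h1 : HasDerivAt (fun r => r ^ (n + 1) * χ r) _ r :=
        (hasDerivAt_pow (n + 1) r).mul (hχ.hasDerivAt r)
      rw [hψχ, h1.deriv]
      simp only [κ, Nat.add_sub_cancel]
      push_cast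
      ring
    have hd2 : ∀ r, deriv (deriv ψ) r = r ^ (n - 1) * (r * deriv κ r + n * κ r) := by
      intro r
      have h1 : HasDerivAt (fun r => r ^ n * κ r) _ r :=
        (hasDerivAt_pow n r).mul (hκ.hasDerivAt r)
      rw [hd1, h1.deriv]
      obtain ⟨m, rfl⟩ : ∃ m, n = m + 1 := ⟨n - 1, by omega⟩
      simp only [Nat.add_sub_cancel]
      ring
    have e1 := integral_radial_second_order hDu hD2u ha.le hb.le hχ hκdef
    have e2 : ∫ x in Metric.ball 0 R, u x * (‖x‖ * deriv κ ‖x‖ + n * κ ‖x‖)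
        = ∫ x in Metric.ball (0 : EuclideanSpace ℝ (Fin n)) R,
          (fun r => g r * (r * deriv κ r + n * κ r)) ‖x‖ := by
      refine integral_congr_ae ?_
      filter_upwards [hg] with x hx
      simp only [hx]
    have e3 : ∫ x in Metric.ball 0 R, F x * χ ‖x‖ = ∫ x,
        {x : EuclideanSpace ℝ (Fin n) | ‖x‖ ∈ Ioo a b}.indicator
          (fun x => F x * (‖x‖ ^ (n + 1))⁻¹) x * ψ ‖x‖ := by
      rw [setIntegral_eq_integral_of_forall_compl_eq_zero]
      · congr with x
        by_cases hx : ‖x‖ ∈ Ioo a b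
        · rw [indicator_of_mem (show x ∈ {x : EuclideanSpace ℝ (Fin n) | ‖x‖ ∈ Ioo a b} from hx),
            mul_assoc]
        · rw [hχ.eq_zero hx, hψ.eq_zero hx, mul_zero, mul_zero]
      · intro x hx
        rw [hχ.eq_zero, mul_zero]
        intro hx'
        exact hx (by simpa using hx'.2.trans hb)
    rw [e2, e3, hHψ a b ψ hψ, setIntegral_ball_norm_eq_of_support hn ha.le hb.le
      (q := fun r => g r * (r * deriv κ r + n * κ r)) fun r hr => by
        simp [hκ.eq_zero hr, hκ.deriv.eq_zero hr]] at e1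
    have e4 : ∀ r, (sphereArea n * g r - H r) * deriv (deriv ψ) r
        = sphereArea n * (g r * deriv (deriv ψ) r) - H r * deriv (deriv ψ) r := fun r => by ring
    simp_rw [e4]
    rw [integral_sub ((hψ.deriv.deriv.integrable_mul hgi).const_mul _)
      (hψ.deriv.deriv.integrable_mul hHi), integral_const_mul, ← e1, sub_eq_zero]
    congr 2 with r
    rw [hd2]
    ring
  obtain ⟨c, e, hce⟩ := ae_eq_affine_of_integral_deriv_deriv hab
    ((hgi.const_mul (sphereArea n)).sub hHi) key
  refine ⟨fun r => (sphereArea n)⁻¹ * (H r + (c + e * r)), by fun_prop, ?_⟩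
  have h3 := ae_norm_of_ae hn hce
  rw [ae_restrict_iff' measurableSet_ball] at hg
  filter_upwards [h3, hg] with x hx hx' hxab
  rw [hx' (by simpa using hxab.2.trans hb)]
  have h4 := hx hxab
  simp only [Pi.sub_apply] at h4
  field_simp
  linarith

/-! ### The weak gradient in terms of the profile. -/

theorem isOpen_annulus {n : ℕ} (a b : ℝ) :
    IsOpen {x : EuclideanSpace ℝ (Fin n) | ‖x‖ ∈ Ioo a b} :=
  isOpen_Ioo.preimage continuous_norm

/-- The weak gradient of a function that is a `C^1` function of the radius. -/
theorem HasWeakGradient.ae_eq_of_profile {n : ℕ} {a b R : ℝ} (ha : 0 ≤ a) (hb : b ≤ R)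
    {u : EuclideanSpace ℝ (Fin n) → ℝ} {Du : EuclideanSpace ℝ (Fin n) → EuclideanSpace ℝ (Fin n)}
    (hu : HasWeakGradient (Metric.ball 0 R) u Du) {G : ℝ → ℝ} (hG : ContDiff ℝ 1 G)
    (hGu : ∀ᵐ x, ‖x‖ ∈ Ioo a b → u x = G ‖x‖) :
    ∀ᵐ x, ‖x‖ ∈ Ioo a b → Du x = (deriv G ‖x‖ * ‖x‖⁻¹) • x := by
  set U : Set (EuclideanSpace ℝ (Fin n)) := {x | ‖x‖ ∈ Ioo a b} with hU
  have hUo : IsOpen U := isOpen_annulus a b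
  have hUR : U ⊆ Metric.ball 0 R := fun x hx => by simpa using hx.2.trans_le hb
  have hG' : Continuous (deriv G) := hG.continuous_deriv le_rfl
  suffices h : ∀ i : Fin n, ∀ᵐ x, x ∈ U → Du x i - deriv G ‖x‖ * ‖x‖⁻¹ * x i = 0 by
    filter_upwards [ae_all_iff.2 h] with x hx hxU
    ext i
    simpa [sub_eq_zero] using hx i hxU
  intro i
  have hx0 : ∀ x ∈ U, x ≠ 0 := fun x hx h => by
    have := hx.1
    rw [h, norm_zero] at this
    linarith
  have h1 : LocallyIntegrableOn (fun x => Du x i) U volume :=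
    (locallyIntegrableOn_coord hu.locInt_grad i).mono_set hUR
  have h2 : LocallyIntegrableOn
      (fun x : EuclideanSpace ℝ (Fin n) => deriv G ‖x‖ * ‖x‖⁻¹ * x i) U volume := by
    refine ContinuousOn.locallyIntegrableOn ?_ hUo.measurableSet
    refine ContinuousOn.mul (ContinuousOn.mul (by fun_prop) ?_) (by fun_prop)
    exact continuousOn_id.norm.inv₀ fun x hx => norm_ne_zero_iff.2 (hx0 x hx)
  refine hUo.ae_eq_zero_of_integral_contDiff_smul_eq_zero (h1.sub h2) ?_
  intro φ hφs hφc hφU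
  have hφ : IsTestFunction (Metric.ball 0 R) φ := ⟨hφs, hφc, hφU.trans hUR⟩
  have hφ' : IsTestFunction U φ := ⟨hφs, hφc, hφU⟩
  have hGl : LocallyIntegrableOn (fun x : EuclideanSpace ℝ (Fin n) => G ‖x‖) U volume :=
    (hG.continuous.comp continuous_norm).locallyIntegrable.locallyIntegrableOn _
  have hz : ∀ x, x ∉ U → φ x = 0 := fun x hx =>
    image_eq_zero_of_notMem_tsupport fun h => hx (hφU h)
  have hz' : ∀ x, x ∉ U → gradient φ x i = 0 := fun x hx => by
    rw [gradient_apply]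
    refine image_eq_zero_of_notMem_tsupport
      (f := fun x => fderiv ℝ φ x (EuclideanSpace.single i 1)) fun h => hx (hφU ?_)
    exact tsupport_fderiv_apply_subset ℝ _ h
  -- The annulus avoids the origin, so G(|x|) is classically differentiable on the support of φ and
  -- can be integrated by parts.
  have e1 : ∫ x, G ‖x‖ * gradient φ x i
      = -∫ x : EuclideanSpace ℝ (Fin n), deriv G ‖x‖ * ‖x‖⁻¹ * x i * φ x := by
    have := integral_bilinear_hasFDerivAt_right_eq_neg_left_of_integrable (μ := volume)
      (f := fun x : EuclideanSpace ℝ (Fin n) => G ‖x‖)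
      (f' := fun x => (deriv G ‖x‖ * ‖x‖⁻¹) • innerSL ℝ x) (g := φ) (g' := fderiv ℝ φ)
      (v := EuclideanSpace.single i 1) (B := ContinuousLinearMap.mul ℝ ℝ)
      (by simpa [EuclideanSpace.inner_single_right] using hφ'.integrable_mul h2)
      (by simpa [gradient_apply] using hφ'.integrable_mul_gradient hGl i)
      (hφ'.integrable_mul hGl)
      (fun x hx => hasFDerivAt_comp_norm (hx0 x (hφU hx))
        (hG.differentiable (by simp) _).hasDerivAt)
      (fun x _ => (hφs.differentiable (by simp) x).hasFDerivAt)
    simpa [gradient_apply, EuclideanSpace.inner_single_right] using this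
  have e2 := hu.integral_eq φ hφ i
  rw [setIntegral_eq_integral_of_forall_compl_eq_zero fun x hx => by
      rw [hz' x fun h => hx (hUR h), mul_zero],
    setIntegral_eq_integral_of_forall_compl_eq_zero fun x hx => by
      rw [hz x fun h => hx (hUR h), mul_zero]] at e2
  have e3 : ∫ x, u x * gradient φ x i = ∫ x, G ‖x‖ * gradient φ x i := by
    refine integral_congr_ae ?_
    filter_upwards [hGu] with x hx
    by_cases hxU : x ∈ U
    · rw [hx hxU]
    · rw [hz' x hxU, mul_zero, mul_zero]
  have e4 : ∀ x : EuclideanSpace ℝ (Fin n),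
      φ x • (Du x i - deriv G ‖x‖ * ‖x‖⁻¹ * x i)
        = Du x i * φ x - deriv G ‖x‖ * ‖x‖⁻¹ * x i * φ x := fun x => by
    rw [smul_eq_mul]; ring
  change ∫ x, φ x • (Du x i - deriv G ‖x‖ * ‖x‖⁻¹ * x i) = 0
  simp_rw [e4]
  rw [integral_sub (hφ'.integrable_mul h1) (hφ'.integrable_mul h2)]
  linarith

/-! ### Equation and stability for the profile. -/

section Ode

variable {n : ℕ} {a b R : ℝ} {f : ℝ → ℝ} {u : EuclideanSpace ℝ (Fin n) → ℝ}
  {Du : EuclideanSpace ℝ (Fin n) → EuclideanSpace ℝ (Fin n)} {G : ℝ → ℝ}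

theorem inner_radial {s t : ℝ} {x : EuclideanSpace ℝ (Fin n)} (hx : 0 < ‖x‖) :
    inner ℝ ((s * ‖x‖⁻¹) • x) ((t * ‖x‖⁻¹) • x) = s * t := by
  rw [real_inner_smul_left, real_inner_smul_right, real_inner_self_eq_norm_sq]
  field_simp

theorem norm_radial_sq {s : ℝ} {x : EuclideanSpace ℝ (Fin n)} (hx : 0 < ‖x‖) :
    ‖(s * ‖x‖⁻¹) • x‖ ^ 2 = s ^ 2 := by
  rw [← real_inner_self_eq_norm_sq, inner_radial hx, sq]

/-- The weak equation for the radial profile. -/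
theorem IsWeakSolution.profile_equation (hn : 0 < n) (ha : 0 ≤ a) (hb : b ≤ R)
    (hu : IsWeakSolution f (Metric.ball 0 R) u Du)
    (hGu : ∀ᵐ x, ‖x‖ ∈ Ioo a b → u x = G ‖x‖)
    (hDu : ∀ᵐ x, ‖x‖ ∈ Ioo a b → Du x = (deriv G ‖x‖ * ‖x‖⁻¹) • x)
    {χ : ℝ → ℝ} (hχ : TestOn a b χ) :
    ∫ r, r ^ (n - 1) * (deriv G r / √(1 + deriv G r ^ 2)) * deriv χ r
      = ∫ r, r ^ (n - 1) * f (G r) * χ r := by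
  have h1 := hu.equation _ (hχ.isTestFunction ha hb)
  have h2 : ∫ x in Metric.ball 0 R, inner ℝ (Du x) (gradient (fun x => χ ‖x‖) x)
      / √(1 + ‖Du x‖ ^ 2) = ∫ x in Metric.ball (0 : EuclideanSpace ℝ (Fin n)) R,
        (fun r => deriv G r / √(1 + deriv G r ^ 2) * deriv χ r) ‖x‖ := by
    refine integral_congr_ae ?_
    filter_upwards [ae_restrict_of_ae hDu] with x hx
    rw [hχ.gradient_comp_norm ha]
    by_cases hxU : ‖x‖ ∈ Ioo a b
    · have hx0 : 0 < ‖x‖ := ha.trans_lt hxU.1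
      rw [hx hxU, inner_radial hx0, norm_radial_sq hx0]
      ring
    · simp [hχ.deriv.eq_zero hxU]
  have h3 : ∫ x in Metric.ball 0 R, f (u x) * χ ‖x‖
      = ∫ x in Metric.ball (0 : EuclideanSpace ℝ (Fin n)) R, (fun r => f (G r) * χ r) ‖x‖ := by
    refine integral_congr_ae ?_
    filter_upwards [ae_restrict_of_ae hGu] with x hx
    by_cases hxU : ‖x‖ ∈ Ioo a b
    · rw [hx hxU]
    · simp [hχ.eq_zero hxU]
  rw [h2, h3,
    setIntegral_ball_norm_eq_of_support hn ha hb
      (q := fun r => deriv G r / √(1 + deriv G r ^ 2) * deriv χ r)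
      (fun r hr => by simp [hχ.deriv.eq_zero hr]),
    setIntegral_ball_norm_eq_of_support hn ha hb (q := fun r => f (G r) * χ r)
      (fun r hr => by simp [hχ.eq_zero hr])] at h1
  simpa only [mul_assoc] using mul_left_cancel₀ (sphereArea_pos hn).ne' h1

/-- The stability inequality for the radial profile. -/
theorem IsStableSolution.profile_stable (hn : 0 < n) (ha : 0 ≤ a) (hb : b ≤ R)
    (hu : IsStableSolution f (Metric.ball 0 R) u Du)
    (hGu : ∀ᵐ x, ‖x‖ ∈ Ioo a b → u x = G ‖x‖)
    (hDu : ∀ᵐ x, ‖x‖ ∈ Ioo a b → Du x = (deriv G ‖x‖ * ‖x‖⁻¹) • x)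
    {χ : ℝ → ℝ} (hχ : TestOn a b χ) :
    ∫ r, r ^ (n - 1) * deriv f (G r) * χ r ^ 2
      ≤ ∫ r, r ^ (n - 1) * ((1 + deriv G r ^ 2) ^ (3 / 2 : ℝ))⁻¹ * deriv χ r ^ 2 := by
  have h1 := hu.stable _ (hχ.isTestFunction ha hb)
  have h2 : ∫ x in Metric.ball 0 R, (‖gradient (fun x => χ ‖x‖) x‖ ^ 2 / √(1 + ‖Du x‖ ^ 2)
      - inner ℝ (Du x) (gradient (fun x => χ ‖x‖) x) ^ 2 / (1 + ‖Du x‖ ^ 2) ^ (3 / 2 : ℝ))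
      = ∫ x in Metric.ball (0 : EuclideanSpace ℝ (Fin n)) R,
        (fun r => ((1 + deriv G r ^ 2) ^ (3 / 2 : ℝ))⁻¹ * deriv χ r ^ 2) ‖x‖ := by
    refine integral_congr_ae ?_
    filter_upwards [ae_restrict_of_ae hDu] with x hx
    rw [hχ.gradient_comp_norm ha]
    by_cases hxU : ‖x‖ ∈ Ioo a b
    · have hx0 : 0 < ‖x‖ := ha.trans_lt hxU.1
      rw [hx hxU, inner_radial hx0, norm_radial_sq hx0, norm_radial_sq hx0]
      -- A radial test function sees only the radial eigenvalue: with s = 1 + G'², s^(-1/2) - G'²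
      -- s^(-3/2) = s^(-3/2).
      have hs : 0 < 1 + deriv G ‖x‖ ^ 2 := by positivity
      have h32 : (1 + deriv G ‖x‖ ^ 2) ^ (3 / 2 : ℝ)
          = (1 + deriv G ‖x‖ ^ 2) * √(1 + deriv G ‖x‖ ^ 2) := by
        rw [Real.sqrt_eq_rpow, show (3 / 2 : ℝ) = 1 + 1 / 2 by norm_num, Real.rpow_add hs,
          Real.rpow_one]
      simp only [h32]
      have := Real.sqrt_pos.2 hs
      field_simp
      ring
    · simp [hχ.deriv.eq_zero hxU]
  have h3 : ∫ x in Metric.ball 0 R, deriv f (u x) * χ ‖x‖ ^ 2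
      = ∫ x in Metric.ball (0 : EuclideanSpace ℝ (Fin n)) R,
        (fun r => deriv f (G r) * χ r ^ 2) ‖x‖ := by
    refine integral_congr_ae ?_
    filter_upwards [ae_restrict_of_ae hGu] with x hx
    by_cases hxU : ‖x‖ ∈ Ioo a b
    · rw [hx hxU]
    · simp [hχ.eq_zero hxU]
  rw [h2, h3,
    setIntegral_ball_norm_eq_of_support hn ha hb
      (q := fun r => ((1 + deriv G r ^ 2) ^ (3 / 2 : ℝ))⁻¹ * deriv χ r ^ 2)
      (fun r hr => by simp [hχ.deriv.eq_zero hr]),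
    setIntegral_ball_norm_eq_of_support hn ha hb (q := fun r => deriv f (G r) * χ r ^ 2)
      (fun r hr => by simp [hχ.eq_zero hr])] at h1
  simpa only [mul_assoc] using le_of_mul_le_mul_left h1 (sphereArea_pos hn)

end Ode

/-! ### From weak to classical: C^1 test functions and regularity of the flux. -/

/-- An inequality between quadratic forms extends from `C_c^∞` to `C_c^1`. -/
theorem integral_sq_le_of_testOn {a b c d : ℝ} (hac : a < c) (hdb : d < b) {p q w : ℝ → ℝ}
    (hp : Continuous p) (hq : Continuous q)
    (H : ∀ χ, TestOn a b χ → ∫ r, p r * χ r ^ 2 ≤ ∫ r, q r * deriv χ r ^ 2)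
    (hw : ContDiff ℝ 1 w) (hw0 : ∀ x, x ∉ Icc c d → w x = 0) :
    ∫ r, p r * w r ^ 2 ≤ ∫ r, q r * deriv w r ^ 2 := by
  obtain ⟨χ, M, hχ, hM, hM', ht, ht'⟩ := exists_testOn_tendsto hac hdb hw hw0
  have key : ∀ (p : ℝ → ℝ) (y : ℕ → ℝ → ℝ) (z : ℝ → ℝ), Continuous p →
      (∀ k, TestOn a b (y k)) → (∀ k x, |y k x| ≤ M) →
      (∀ x, Filter.Tendsto (fun k => y k x) Filter.atTop (nhds (z x))) →
      Filter.Tendsto (fun k => ∫ r, p r * y k r ^ 2) Filter.atTop (nhds (∫ r, p r * z r ^ 2)) := by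
    intro p y z hp hy hyM hyt
    refine tendsto_integral_of_dominated_convergence
      ((Ioo a b).indicator fun r => |p r| * M ^ 2) (fun k => ?_) ?_ (fun k => ae_of_all _ fun r => ?_)
      (ae_of_all _ fun r => ((hyt r).pow 2).const_mul _)
    · exact (hp.mul ((hy k).continuous.pow 2)).aestronglyMeasurable
    · rw [integrable_indicator_iff measurableSet_Ioo]
      exact (hp.abs.mul continuous_const).integrableOn_Icc.mono_set Ioo_subset_Icc_self
    · by_cases hr : r ∈ Ioo a b
      · rw [indicator_of_mem hr, Real.norm_eq_abs, abs_mul, abs_pow]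
        have := hyM k r
        gcongr
      · rw [indicator_of_notMem hr, (hy k).eq_zero hr]
        simp
  exact le_of_tendsto_of_tendsto' (key p χ w hp hχ hM ht)
    (key q (fun k => deriv (χ k)) (deriv w) hq (fun k => (hχ k).deriv) hM' ht')
    fun k => H _ (hχ k)

/-- A continuous weak solution of `W' = -F` with `F` continuous is a classical one. -/
theorem hasDerivAt_of_weak {a b : ℝ} (hab : a < b) {W F : ℝ → ℝ} (hW : Continuous W)
    (hF : Continuous F)
    (H : ∀ χ, TestOn a b χ → ∫ r, W r * deriv χ r = ∫ r, F r * χ r) {r : ℝ} (hr : r ∈ Ioo a b) :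
    HasDerivAt W (-F r) r ∧ ContDiffAt ℝ 1 W r := by
  obtain ⟨hR, hRd⟩ := contDiff_primitive hF a
  set P : ℝ → ℝ := fun r => ∫ s in a..r, F s with hP
  have hi : ∀ (p q : ℝ → ℝ), Continuous p → TestOn a b q → Integrable (fun r => p r * q r) :=
    fun p q hp hq => hq.integrable_mul (hp.integrableOn_Icc.mono_set Ioo_subset_Icc_self)
  -- W plus the primitive of F has zero weak derivative; continuity then upgrades the a.e. constant
  -- to a constant.
  obtain ⟨c, hc⟩ := ae_eq_const_of_integral_deriv hab (h := fun r => W r + P r)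
    ((hW.add hR.continuous).integrableOn_Icc.mono_set Ioo_subset_Icc_self) fun χ hχ => by
      have h1 := integral_mul_deriv_eq_deriv_mul_of_integrable (u := P) (v := χ)
        (fun x _ => hRd x) (fun x _ => hχ.hasDerivAt x) (hi _ _ hR.continuous hχ.deriv)
        (hi _ _ hF hχ) (hi _ _ hR.continuous hχ)
      simp_rw [add_mul]
      rw [integral_add (hi _ _ hW hχ.deriv) (hi _ _ hR.continuous hχ.deriv), H χ hχ, h1]
      ring
  have heq : EqOn (fun r => W r + P r) (fun _ => c) (Ioo a b) := by
    refine Measure.eqOn_open_of_ae_eq (μ := volume) ?_ isOpen_Ioo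
      (hW.add hR.continuous).continuousOn continuousOn_const
    rw [Filter.EventuallyEq, ae_restrict_iff' measurableSet_Ioo]
    exact hc
  have heq' : W =ᶠ[nhds r] fun r => c - P r := by
    filter_upwards [isOpen_Ioo.mem_nhds hr] with s hs
    have := heq hs
    simp only at this
    linarith
  exact ⟨((hRd r).const_sub c).congr_of_eventuallyEq heq',
    (contDiffAt_const.sub hR.contDiffAt).congr_of_eventuallyEq heq'⟩

theorem one_sub_flux_sq (v : ℝ) : 1 - (v / √(1 + v ^ 2)) ^ 2 = (1 + v ^ 2)⁻¹ := by
  have hs : 0 < 1 + v ^ 2 := by positivity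
  rw [div_pow, Real.sq_sqrt hs.le]
  field_simp
  ring

/-- The flux has the inverse y/√(1-y²), smooth on (-1, 1), so regularity of the flux passes to v. -/
theorem flux_inverse (v : ℝ) :
    v / √(1 + v ^ 2) / √(1 - (v / √(1 + v ^ 2)) ^ 2) = v := by
  have hs : 0 < 1 + v ^ 2 := by positivity
  have := Real.sqrt_pos.2 hs
  rw [one_sub_flux_sq, Real.sqrt_inv]
  field_simp

/-- This is the weight of the radial stability form, which is why differentiating the equation
produces the linearised operator. -/
theorem hasDerivAt_flux (v : ℝ) :
    HasDerivAt (fun v : ℝ => v / √(1 + v ^ 2)) ((1 + v ^ 2) ^ (3 / 2 : ℝ))⁻¹ v := by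
  have hs : 0 < 1 + v ^ 2 := by positivity
  have hs' := Real.sqrt_pos.2 hs
  have h1 : HasDerivAt (fun v : ℝ => 1 + v ^ 2) (2 * v) v := by
    simpa using (hasDerivAt_pow 2 v).const_add 1
  have h2 : HasDerivAt (fun v : ℝ => v / √(1 + v ^ 2)) _ v :=
    (hasDerivAt_id v).div (h1.sqrt hs.ne') hs'.ne'
  convert h2 using 1
  have h32 : (1 + v ^ 2) ^ (3 / 2 : ℝ) = (1 + v ^ 2) * √(1 + v ^ 2) := by
    rw [Real.sqrt_eq_rpow, show (3 / 2 : ℝ) = 1 + 1 / 2 by norm_num, Real.rpow_add hs,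
      Real.rpow_one]
  have h4 : √(1 + v ^ 2) ^ 2 = 1 + v ^ 2 := Real.sq_sqrt hs.le
  rw [h32, id]
  field_simp
  rw [h4]
  ring

/-- A continuous function is of class `C^1` where its flux, weighted by a power, is. -/
theorem contDiffAt_of_flux {m : ℕ} {v : ℝ → ℝ} {r : ℝ} (hr : 0 < r)
    (hW : ContDiffAt ℝ 1 (fun r => r ^ m * (v r / √(1 + v r ^ 2))) r) : ContDiffAt ℝ 1 v r := by
  have hp : ContDiffAt ℝ 1 (fun r => (r ^ m)⁻¹ * (r ^ m * (v r / √(1 + v r ^ 2)))) r :=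
    ((contDiffAt_id.pow m).inv (pow_ne_zero _ hr.ne')).mul hW
  have hp' : ContDiffAt ℝ 1 (fun r => v r / √(1 + v r ^ 2)) r := by
    refine hp.congr_of_eventuallyEq ?_
    filter_upwards [lt_mem_nhds hr] with s hs
    have := pow_ne_zero m hs.ne'
    field_simp
  have h1 : 0 < 1 - (v r / √(1 + v r ^ 2)) ^ 2 := by
    rw [one_sub_flux_sq]; positivity
  have h2 : ContDiffAt ℝ 1 (fun r => v r / √(1 + v r ^ 2) / √(1 - (v r / √(1 + v r ^ 2)) ^ 2)) r :=
    hp'.div ((contDiffAt_const.sub (hp'.pow 2)).sqrt h1.ne') (Real.sqrt_pos.2 h1).ne'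
  exact h2.congr_of_eventuallyEq (.of_forall fun s => (flux_inverse (v s)).symm)

theorem integrable_of_continuousOn_Icc {c d : ℝ} {h : ℝ → ℝ} (hc : ContinuousOn h (Icc c d))
    (h0 : ∀ r, r ∉ Icc c d → h r = 0) : Integrable h := by
  refine (integrableOn_iff_integrable_of_support_subset fun x hx => ?_).1 hc.integrableOn_Icc
  by_contra hx'
  exact hx (h0 x hx')

/-! ### Stability tested with the derivative of the profile. -/

/-- Stability of a radial profile `G`, tested with `G' η`. -/
theorem profile_stability_inequality {m : ℕ} {a b c d : ℝ} (ha : 0 < a) (hac : a < c)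
    (hcd : c ≤ d) (hdb : d < b) {f G η : ℝ → ℝ} (hf : ContDiff ℝ 1 f) (hG : ContDiff ℝ 1 G)
    (heq : ∀ χ, TestOn a b χ →
      ∫ r, r ^ m * (deriv G r / √(1 + deriv G r ^ 2)) * deriv χ r = ∫ r, r ^ m * f (G r) * χ r)
    (hst : ∀ χ, TestOn a b χ → ∫ r, r ^ m * deriv f (G r) * χ r ^ 2
      ≤ ∫ r, r ^ m * ((1 + deriv G r ^ 2) ^ (3 / 2 : ℝ))⁻¹ * deriv χ r ^ 2)
    (hη : ContDiff ℝ 1 η) (hη0 : ∀ r, r ∉ Icc c d → η r = 0) :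
    Integrable (fun r => r ^ m * (deriv G r / √(1 + deriv G r ^ 2)) * deriv G r / r ^ 2 * η r ^ 2) ∧
    m * ∫ r, r ^ m * (deriv G r / √(1 + deriv G r ^ 2)) * deriv G r / r ^ 2 * η r ^ 2
      ≤ ∫ r, r ^ m * ((1 + deriv G r ^ 2) ^ (3 / 2 : ℝ))⁻¹ * deriv G r ^ 2 * deriv η r ^ 2 := by
  set v : ℝ → ℝ := deriv G with hv
  set q : ℝ → ℝ := fun r => r ^ m * ((1 + v r ^ 2) ^ (3 / 2 : ℝ))⁻¹ with hq
  set W : ℝ → ℝ := fun r => r ^ m * (v r / √(1 + v r ^ 2)) with hW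
  set F : ℝ → ℝ := fun r => r ^ m * f (G r) with hF
  have hs : ∀ r, 0 < 1 + v r ^ 2 := fun r => by positivity
  have hvc : Continuous v := hG.continuous_deriv le_rfl
  have hf'c : Continuous (deriv f) := hf.continuous_deriv le_rfl
  have hηc : Continuous (deriv η) := hη.continuous_deriv le_rfl
  have hGc := hG.continuous
  have hfc := hf.continuous
  have hηc0 := hη.continuous
  have hqc : Continuous q := (continuous_pow m).mul
    (((continuous_const.add (hvc.pow 2)).rpow_const fun r => Or.inl (hs r).ne').inv₀
      fun r => (Real.rpow_pos_of_pos (hs r) _).ne')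
  have hWc : Continuous W := (continuous_pow m).mul
    (hvc.div (continuous_const.add (hvc.pow 2)).sqrt fun r => (Real.sqrt_pos.2 (hs r)).ne')
  have hFc : Continuous F := (continuous_pow m).mul (hfc.comp hGc)
  have hWd : ∀ r ∈ Ioo a b, HasDerivAt W (-F r) r ∧ ContDiffAt ℝ 1 W r := fun r hr =>
    hasDerivAt_of_weak (hac.trans_le (hcd.trans hdb.le)) hWc hFc heq hr
  have hpos : ∀ r ∈ Ioo a b, 0 < r := fun r hr => ha.trans hr.1
  have hvd : ∀ r ∈ Ioo a b, ContDiffAt ℝ 1 v r := fun r hr =>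
    contDiffAt_of_flux (hpos r hr) (hWd r hr).2
  have hv' : ∀ r ∈ Ioo a b, HasDerivAt v (deriv v r) r := fun r hr =>
    ((hvd r hr).differentiableAt (by simp)).hasDerivAt
  have hη' : ∀ r, HasDerivAt η (deriv η r) r := fun r =>
    (hη.differentiable (by simp) r).hasDerivAt
  have hIoo : ∀ r ∈ Icc c d, r ∈ Ioo a b := fun r hr =>
    ⟨hac.trans_le hr.1, hr.2.trans_lt hdb⟩
  have hη'0 : ∀ r, r ∉ Icc c d → deriv η r = 0 := fun _ hr =>
    deriv_eq_zero_of_notMem_Icc hη0 hr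
  set w : ℝ → ℝ := fun r => v r * η r with hw
  have hw0 : ∀ r, r ∉ Icc c d → w r = 0 := fun r hr => by simp [w, hη0 r hr]
  have hwC : ContDiff ℝ 1 w := by
    refine contDiff_iff_contDiffAt.2 fun r => ?_
    by_cases hr : r ∈ Ioo a b
    · exact (hvd r hr).mul hη.contDiffAt
    · have : w =ᶠ[nhds r] fun _ => 0 := by
        have hr' : r ∉ Icc c d := fun h => hr (hIoo r h)
        filter_upwards [isClosed_Icc.isOpen_compl.mem_nhds hr'] with y hy using hw0 y hy
      exact contDiffAt_const.congr_of_eventuallyEq this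
  have hw' : ∀ r ∈ Ioo a b, deriv w r = deriv v r * η r + v r * deriv η r := fun r hr => by
    have : HasDerivAt w _ r := (hv' r hr).mul (hη' r)
    exact this.deriv
  have hw'0 : ∀ r, r ∉ Icc c d → deriv w r = 0 := fun _ hr =>
    deriv_eq_zero_of_notMem_Icc hw0 hr
  have hwc : Continuous w := hwC.continuous
  have hw'c : Continuous (deriv w) := hwC.continuous_deriv le_rfl
  have hstab := integral_sq_le_of_testOn hac hdb
    (p := fun r => r ^ m * deriv f (G r)) (q := q) (by fun_prop) hqc hst hwC hw0
  -- `Z = q v'` on `(a, b)`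
  set Z : ℝ → ℝ := fun r => -F r - m * (W r / r) with hZ
  have hZq : ∀ r ∈ Ioo a b, Z r = q r * deriv v r := fun r hr => by
    have hr0 := (hpos r hr).ne'
    have h1 : HasDerivAt W _ r :=
      (hasDerivAt_pow m r).mul ((hasDerivAt_flux (v r)).comp r (hv' r hr))
    have h2 := (hWd r hr).1.unique h1
    -- The exponent m - 1 is truncated; for m = 0 both sides vanish.
    have h3 : (m : ℝ) * (W r / r) = m * r ^ (m - 1) * (v r / √(1 + v r ^ 2)) := by
      rcases m with _ | k
      · simp
      · simp only [W, Nat.add_sub_cancel, pow_succ]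
        field_simp
    simp only [hZ, hq]
    rw [h3]
    linarith
  -- Substituting W' = -F, the two terms mF/r cancel. What survives besides the linearised term is
  -- mW/r², the source of the estimate.
  have hZd : ∀ r ∈ Ioo a b,
      HasDerivAt Z (-(r ^ m * deriv f (G r) * v r) + m * (W r / r ^ 2)) r := fun r hr => by
    have hr0 := (hpos r hr).ne'
    have hGd : HasDerivAt G (v r) r := (hG.differentiable (by simp) r).hasDerivAt
    have hfd : HasDerivAt f (deriv f (G r)) (G r) :=
      (hf.differentiable (by simp) _).hasDerivAt
    have h1 : HasDerivAt F _ r := (hasDerivAt_pow m r).mul (hfd.comp r hGd)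
    have h2 : HasDerivAt Z _ r :=
      h1.neg.sub ((((hWd r hr).1).div (hasDerivAt_id r) hr0).const_mul (m : ℝ))
    convert h2 using 1
    have h3 : (m : ℝ) * r ^ (m - 1) * f (G r) = m * (F r / r) := by
      rcases m with _ | k
      · simp
      · simp only [F, Nat.add_sub_cancel, pow_succ]
        field_simp
    simp only [id]
    rw [h3]
    field_simp
    ring
  have hI0 : Integrable (fun r => W r * v r / r ^ 2 * η r ^ 2) := by
    refine integrable_of_continuousOn_Icc (c := c) (d := d) ?_ fun r hr => by simp [hη0 r hr]
    refine ContinuousOn.mul (ContinuousOn.div (by fun_prop) (by fun_prop) fun r hr => ?_)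
      (by fun_prop)
    exact pow_ne_zero _ (hpos r (hIoo r hr)).ne'
  have hI1 : Integrable (fun r => r ^ m * deriv f (G r) * w r ^ 2) :=
    integrable_of_continuousOn_Icc (c := c) (d := d) (by fun_prop) fun r hr => by simp [hw0 r hr]
  have hI2 : Integrable (fun r => q r * deriv w r ^ 2) :=
    integrable_of_continuousOn_Icc (c := c) (d := d) (by fun_prop) fun r hr => by simp [hw'0 r hr]
  have hI3 : Integrable (fun r => q r * v r ^ 2 * deriv η r ^ 2) :=
    integrable_of_continuousOn_Icc (c := c) (d := d) (by fun_prop) fun r hr => by simp [hη'0 r hr]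
  refine ⟨hI0, ?_⟩
  -- With w = vη and Z = qv', expanding gives qv'(w'η + wη') = qw'² - qv²η'². The product Zwη has
  -- compact support, so its derivative integrates to zero, and stability bounds ∫ r^m f'(G) w² - ∫
  -- qw' ² by 0.
  have hyd : ∀ r, HasDerivAt (fun r => Z r * (w r * η r))
      (m * (W r * v r / r ^ 2 * η r ^ 2) - r ^ m * deriv f (G r) * w r ^ 2
        + (q r * deriv w r ^ 2 - q r * v r ^ 2 * deriv η r ^ 2)) r := by
    intro r
    by_cases hr : r ∈ Ioo a b
    · have h1 : HasDerivAt (fun r => Z r * (w r * η r)) _ r :=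
        (hZd r hr).mul (((hwC.differentiable (by simp) r).hasDerivAt).mul (hη' r))
      convert h1 using 1
      rw [hZq r hr, hw' r hr]
      ring
    · have hr' : r ∉ Icc c d := fun h => hr (hIoo r h)
      have h1 : (fun r => Z r * (w r * η r)) =ᶠ[nhds r] fun _ => 0 := by
        filter_upwards [isClosed_Icc.isOpen_compl.mem_nhds hr'] with y hy
        simp [hη0 y hy]
      refine ((hasDerivAt_const r (0 : ℝ)).congr_of_eventuallyEq h1).congr_deriv ?_
      simp [hη0 r hr', hw0 r hr', hw'0 r hr', hη'0 r hr']
  have hyi : Integrable (fun r => Z r * (w r * η r)) :=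
    integrable_of_continuousOn_Icc (c := c) (d := d)
      (fun r _ => (hyd r).continuousAt.continuousWithinAt) fun r hr => by simp [hη0 r hr]
  have hI4 : Integrable (fun r => m * (W r * v r / r ^ 2 * η r ^ 2)
      - r ^ m * deriv f (G r) * w r ^ 2) := (hI0.const_mul _).sub hI1
  have hI5 : Integrable (fun r => q r * deriv w r ^ 2 - q r * v r ^ 2 * deriv η r ^ 2) :=
    hI2.sub hI3
  have h0 := integral_eq_zero_of_hasDerivAt_of_integrable hyd (hI4.add hI5) hyi
  rw [integral_add hI4 hI5, integral_sub (hI0.const_mul _) hI1,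
    integral_sub hI2 hI3, integral_const_mul] at h0
  change _ ≤ ∫ r, q r * v r ^ 2 * deriv η r ^ 2
  linarith

/-! ### Truncated powers. -/

theorem exists_bound_deriv_smoothTransition :
    ∃ M : ℝ, 0 ≤ M ∧ (∀ x, |deriv Real.smoothTransition x| ≤ M) ∧
      ∀ x, 1 < x → deriv Real.smoothTransition x = 0 := by
  have hc : Continuous (deriv Real.smoothTransition) :=
    (Real.smoothTransition.contDiff (n := 1)).continuous_deriv le_rfl
  obtain ⟨M, hM⟩ := (isCompact_Icc (a := (0 : ℝ)) (b := 1)).exists_bound_of_continuousOn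
    hc.continuousOn
  have h1 : ∀ x : ℝ, 1 < x → deriv Real.smoothTransition x = 0 := fun x hx => by
    have : Real.smoothTransition =ᶠ[nhds x] fun _ => 1 := by
      filter_upwards [lt_mem_nhds hx] with y hy using Real.smoothTransition.one_of_one_le hy.le
    rw [this.deriv_eq]; simp
  have h0 : ∀ x : ℝ, x < 0 → deriv Real.smoothTransition x = 0 := fun x hx => by
    have : Real.smoothTransition =ᶠ[nhds x] fun _ => 0 := by
      filter_upwards [gt_mem_nhds hx] with y hy using Real.smoothTransition.zero_of_nonpos hy.le
    rw [this.deriv_eq]; simp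
  have hM0 : 0 ≤ M := (norm_nonneg _).trans (hM 0 (by simp))
  refine ⟨M, hM0, fun x => ?_, h1⟩
  by_cases hx0 : x < 0
  · simpa [h0 x hx0] using hM0
  by_cases hx1 : 1 < x
  · simpa [h1 x hx1] using hM0
  · exact hM x ⟨not_lt.1 hx0, not_lt.1 hx1⟩

/-- Truncations of the power `r ^ (-β)` near `0` and beyond `1`, with scale invariant control of
the derivative. -/
theorem exists_cutoff_power (β : ℝ) :
    ∃ D : ℝ, 0 ≤ D ∧ ∀ ε : ℝ, 0 < ε → ∃ η : ℝ → ℝ, ContDiff ℝ 1 η ∧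
      (∀ r, r ∉ Icc ε (3 / 2) → η r = 0) ∧ (∀ r, 2 * ε ≤ r → r ≤ 1 → η r = r ^ (-β)) ∧
      ∀ r ∈ Icc ε (3 / 2), |r * deriv η r| ≤ D * r ^ (-β) := by
  obtain ⟨M, hM0, hM, hM1⟩ := exists_bound_deriv_smoothTransition
  -- |β| comes from the power, 2M from the inner cutoff (where r/ε ≤ 2), 3M from the outer one
  -- (where 2r ≤ 3).
  refine ⟨|β| + 2 * M + 3 * M, by positivity, fun ε hε => ?_⟩
  set S := Real.smoothTransition with hS
  have hSC : ContDiff ℝ 1 S := Real.smoothTransition.contDiff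
  have hSd : ∀ x, HasDerivAt S (deriv S x) x := fun x =>
    (hSC.differentiable (by simp) x).hasDerivAt
  have hSabs : ∀ x, |S x| ≤ 1 := fun x => by
    rw [abs_of_nonneg (Real.smoothTransition.nonneg x)]
    exact Real.smoothTransition.le_one x
  have hz : ∀ r, r ∉ Icc ε (3 / 2) → S (r / ε - 1) * S (3 - 2 * r) = 0 := fun r hr => by
    by_cases h : ε ≤ r
    · have h2 : 3 / 2 < r := by
        by_contra h2
        exact hr ⟨h, not_lt.1 h2⟩
      rw [hS, Real.smoothTransition.zero_of_nonpos (x := 3 - 2 * r) (by linarith), mul_zero]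
    · rw [hS, Real.smoothTransition.zero_of_nonpos (x := r / ε - 1), zero_mul]
      rw [sub_nonpos, div_le_one hε]
      linarith
  -- The first factor rises on [ε, 2ε], the second falls on [1, 3/2].
  refine ⟨fun r => r ^ (-β) * (S (r / ε - 1) * S (3 - 2 * r)), ?_, fun r hr => ?_,
    fun r hr hr1 => ?_, fun r hr => ?_⟩
  · refine contDiff_iff_contDiffAt.2 fun r => ?_
    by_cases hr : 0 < r
    · refine (Real.contDiffAt_rpow_const_of_ne hr.ne').mul (ContDiff.contDiffAt ?_)
      exact (hSC.comp (by fun_prop)).mul (hSC.comp (by fun_prop))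
    · refine (contDiffAt_const (c := (0 : ℝ))).congr_of_eventuallyEq ?_
      filter_upwards [gt_mem_nhds (show r < ε by linarith)] with s hs
      rw [hz s fun h => absurd h.1 (not_le.2 hs), mul_zero]
  · simp only [hz r hr, mul_zero]
  · simp only [hS]
    rw [Real.smoothTransition.one_of_one_le (x := 3 - 2 * r) (by linarith),
      Real.smoothTransition.one_of_one_le (x := r / ε - 1), mul_one, mul_one]
    have : 2 ≤ r / ε := by rwa [le_div_iff₀ hε]
    linarith
  · have hr0 : 0 < r := hε.trans_le hr.1
    have h1 : HasDerivAt (fun r => S (r / ε - 1)) (deriv S (r / ε - 1) * (1 / ε)) r :=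
      (hSd _).comp r (((hasDerivAt_id r).div_const ε).sub_const 1)
    have h2 : HasDerivAt (fun r => S (3 - 2 * r)) (deriv S (3 - 2 * r) * (-(2 * 1))) r :=
      (hSd _).comp r (((hasDerivAt_id r).const_mul 2).const_sub 3)
    have h3 : HasDerivAt (fun r => r ^ (-β) * (S (r / ε - 1) * S (3 - 2 * r))) _ r :=
      (Real.hasDerivAt_rpow_const (p := -β) (Or.inl hr0.ne')).mul (h1.mul h2)
    have h4 : r * r ^ (-β - 1) = r ^ (-β) := by
      rw [Real.rpow_sub_one hr0.ne']; field_simp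
    have h5 : r * deriv (fun r => r ^ (-β) * (S (r / ε - 1) * S (3 - 2 * r))) r
        = (-β * (S (r / ε - 1) * S (3 - 2 * r)) + r / ε * deriv S (r / ε - 1) * S (3 - 2 * r)
          + -2 * r * deriv S (3 - 2 * r) * S (r / ε - 1)) * r ^ (-β) := by
      rw [h3.deriv]
      linear_combination (-β * (S (r / ε - 1) * S (3 - 2 * r))) * h4
    rw [h5, abs_mul, abs_of_pos (Real.rpow_pos_of_pos hr0 _)]
    have b1 : |-β * (S (r / ε - 1) * S (3 - 2 * r))| ≤ |β| := by
      rw [abs_mul, abs_mul, abs_neg]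
      exact mul_le_of_le_one_right (abs_nonneg _)
        (mul_le_one₀ (hSabs _) (abs_nonneg _) (hSabs _))
    have b2 : |r / ε * deriv S (r / ε - 1) * S (3 - 2 * r)| ≤ 2 * M := by
      rw [abs_mul]
      refine (mul_le_of_le_one_right (abs_nonneg _) (hSabs _)).trans ?_
      -- Beyond 2ε the inner cutoff is constant, so the large factor r/ε meets a zero derivative;
      -- this keeps D independent of ε.
      by_cases h : r / ε ≤ 2
      · rw [abs_mul, abs_of_pos (div_pos hr0 hε)]
        exact mul_le_mul h (hM _) (abs_nonneg _) (by norm_num)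
      · rw [hM1 _ (by linarith [not_le.1 h])]
        simpa using hM0
    have b3 : |-2 * r * deriv S (3 - 2 * r) * S (r / ε - 1)| ≤ 3 * M := by
      rw [abs_mul]
      refine (mul_le_of_le_one_right (abs_nonneg _) (hSabs _)).trans ?_
      rw [abs_mul, abs_mul, abs_neg, abs_two, abs_of_pos hr0]
      exact mul_le_mul (by linarith [hr.2]) (hM _) (abs_nonneg _) (by norm_num)
    gcongr
    exact (abs_add_three _ _ _).trans (by linarith)

/-! ### The integral estimate for profiles. -/

/-- For |v| > 1 one has √(1+v²) ≤ 2|v|, so the flux term is at least |v|/2; the constant 1 covers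
|v| ≤ 1. -/
theorem abs_le_one_add_flux_mul (v : ℝ) : |v| ≤ 1 + 2 * (v / √(1 + v ^ 2) * v) := by
  have hs : 0 < 1 + v ^ 2 := by positivity
  have h0 : v / √(1 + v ^ 2) * v = v ^ 2 / √(1 + v ^ 2) := by ring
  rw [h0]
  by_cases h : |v| ≤ 1
  · have : 0 ≤ v ^ 2 / √(1 + v ^ 2) := by positivity
    linarith
  · have h1 : 1 < |v| := not_le.1 h
    have h2 : √(1 + v ^ 2) ≤ 2 * |v| := by
      rw [Real.sqrt_le_left (by positivity), ← sq_abs v]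
      nlinarith
    have h3 : |v| / 2 ≤ v ^ 2 / √(1 + v ^ 2) := by
      rw [le_div_iff₀ (Real.sqrt_pos.2 hs)]
      nlinarith [sq_abs v]
    linarith

theorem integrableOn_rpow_neg {α : ℝ} (hα : α < 1) :
    IntegrableOn (fun r : ℝ => r ^ (-α)) (Ioo 0 2) := by
  have := intervalIntegral.intervalIntegrable_rpow' (a := 0) (b := 2) (r := -α) (by linarith)
  rw [intervalIntegrable_iff_integrableOn_Ioo_of_le (by norm_num)] at this
  exact this

/-- The gradient estimate for radial profiles. -/
theorem exists_profile_bound {m : ℕ} (hm : 1 ≤ m) {α : ℝ} (hα0 : 0 < α) (hα1 : α < 1) :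
    ∃ K : ℝ, 0 < K ∧ ∀ (δ ρ : ℝ) (f G : ℝ → ℝ), 0 < δ → δ ≤ 1 → 0 < ρ → ρ < 1 →
      ContDiff ℝ 1 f → ContDiff ℝ 1 G →
      (∀ χ, TestOn (δ / 4) (7 / 4) χ →
        ∫ r, r ^ m * (deriv G r / √(1 + deriv G r ^ 2)) * deriv χ r
          = ∫ r, r ^ m * f (G r) * χ r) →
      (∀ χ, TestOn (δ / 4) (7 / 4) χ → ∫ r, r ^ m * deriv f (G r) * χ r ^ 2
        ≤ ∫ r, r ^ m * ((1 + deriv G r ^ 2) ^ (3 / 2 : ℝ))⁻¹ * deriv χ r ^ 2) →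
      ∫ r in Ioo δ ρ, r ^ m * |deriv G r| ≤ K * ρ ^ (m + α : ℝ) := by
  -- This exponent β solves m - 2 - 2β = -α.
  obtain ⟨D, hD0, hD⟩ := exists_cutoff_power ((m - 2 + α) / 2)
  set β : ℝ := (m - 2 + α) / 2 with hβ
  have hL0 : 0 ≤ ∫ r : ℝ in Ioo 0 2, r ^ (-α) :=
    setIntegral_nonneg measurableSet_Ioo fun r hr => Real.rpow_nonneg hr.1.le _
  set L := ∫ r : ℝ in Ioo 0 2, r ^ (-α) with hL
  have hpow : ∀ r : ℝ, 0 < r → r ^ m / r ^ 2 * (r ^ (-β)) ^ 2 = r ^ (-α) := fun r hr => by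
    rw [← Real.rpow_natCast r m, ← Real.rpow_natCast r 2, ← Real.rpow_natCast (r ^ (-β)) 2,
      ← Real.rpow_mul hr.le, ← Real.rpow_sub hr, ← Real.rpow_add hr]
    congr 1
    push_cast
    rw [hβ]
    ring
  refine ⟨1 + 2 * (D ^ 2 * L), by positivity, fun δ ρ f G hδ hδ1 hρ hρ1 hf hG heq hst => ?_⟩
  -- The choice ε = δ/2 makes η the pure power on [δ, 1], with support in [δ/2, 3/2], strictly
  -- inside (δ/4, 7/4).
  obtain ⟨η, hη, hη0, hηeq, hηd⟩ := hD (δ / 2) (by linarith)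
  obtain ⟨hI, hle⟩ := profile_stability_inequality (a := δ / 4) (b := 7 / 4) (c := δ / 2)
    (d := 3 / 2) (by linarith) (by linarith) (by linarith) (by norm_num) hf hG heq hst hη hη0
  set v : ℝ → ℝ := deriv G with hv
  have hvc : Continuous v := hG.continuous_deriv le_rfl
  set J : ℝ → ℝ := fun r => r ^ m * (v r / √(1 + v r ^ 2)) * v r / r ^ 2 * η r ^ 2 with hJ
  have hJ0 : ∀ r, 0 ≤ J r := fun r => by
    by_cases hr : r ∈ Icc (δ / 2) (3 / 2)
    · have hr0 : 0 < r := by linarith [hr.1]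
      have : J r = r ^ m * (v r ^ 2 / √(1 + v r ^ 2)) / r ^ 2 * η r ^ 2 := by
        simp only [J]; ring
      rw [this]
      positivity
    · simp [J, hη0 r hr]
  have hη'0 : ∀ r, r ∉ Icc (δ / 2) (3 / 2) → deriv η r = 0 := fun _ hr =>
    deriv_eq_zero_of_notMem_Icc hη0 hr
  have hs : ∀ r, 1 ≤ 1 + v r ^ 2 := fun r => by nlinarith [sq_nonneg (v r)]
  -- From here on the bound for the right side no longer depends on the solution.
  have hv1 : ∀ r, ((1 + v r ^ 2) ^ (3 / 2 : ℝ))⁻¹ * v r ^ 2 ≤ 1 := fun r => by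
    have h1 : 1 + v r ^ 2 ≤ (1 + v r ^ 2) ^ (3 / 2 : ℝ) :=
      Real.self_le_rpow_of_one_le (hs r) (by norm_num)
    rw [inv_mul_le_one₀ (by linarith [hs r])]
    linarith
  have hR : ∫ r, r ^ m * ((1 + v r ^ 2) ^ (3 / 2 : ℝ))⁻¹ * v r ^ 2 * deriv η r ^ 2
      ≤ D ^ 2 * L := by
    have hbi : Integrable ((Ioo (0 : ℝ) 2).indicator fun r => D ^ 2 * r ^ (-α)) :=
      (integrable_indicator_iff measurableSet_Ioo).2 ((integrableOn_rpow_neg hα1).const_mul _)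
    have hbe : ∫ r, (Ioo (0 : ℝ) 2).indicator (fun r => D ^ 2 * r ^ (-α)) r = D ^ 2 * L := by
      rw [integral_indicator measurableSet_Ioo, integral_const_mul]
    rw [← hbe]
    refine integral_mono_of_nonneg (ae_of_all _ fun r => ?_) hbi (ae_of_all _ fun r => ?_)
    · by_cases hr : r ∈ Icc (δ / 2) (3 / 2)
      · have hr0 : 0 < r := by linarith [hr.1]
        have := hs r
        simp only [Pi.zero_apply]
        positivity
      · simp [hη'0 r hr]
    · by_cases hr : r ∈ Icc (δ / 2) (3 / 2)
      · have hr0 : 0 < r := by linarith [hr.1]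
        have hr2 : r ∈ Ioo (0 : ℝ) 2 := ⟨hr0, by linarith [hr.2]⟩
        simp only [indicator_of_mem hr2]
        have h1 : (r * deriv η r) ^ 2 ≤ (D * r ^ (-β)) ^ 2 := by
          rw [← sq_abs (r * deriv η r)]
          exact pow_le_pow_left₀ (abs_nonneg _) (hηd r hr) 2
        calc r ^ m * ((1 + v r ^ 2) ^ (3 / 2 : ℝ))⁻¹ * v r ^ 2 * deriv η r ^ 2
            = (((1 + v r ^ 2) ^ (3 / 2 : ℝ))⁻¹ * v r ^ 2)
              * (r ^ m / r ^ 2 * (r * deriv η r) ^ 2) := by field_simp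
          _ ≤ 1 * (r ^ m / r ^ 2 * (D * r ^ (-β)) ^ 2) := by
              have := hv1 r
              gcongr
          _ = D ^ 2 * (r ^ m / r ^ 2 * (r ^ (-β)) ^ 2) := by ring
          _ = D ^ 2 * r ^ (-α) := by rw [hpow r hr0]
      · simp only [hη'0 r hr]
        have : 0 ≤ (Ioo (0 : ℝ) 2).indicator (fun r => D ^ 2 * r ^ (-α)) r :=
          indicator_nonneg (fun s hs => mul_nonneg (sq_nonneg _) (Real.rpow_nonneg hs.1.le _)) r
        simpa using this
  -- Here m ≥ 1 allows the factor m to be dropped.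
  have hJle : ∫ r, J r ≤ D ^ 2 * L := by
    have h1 : (1 : ℝ) ≤ m := by exact_mod_cast hm
    have h2 : 0 ≤ ∫ r, J r := integral_nonneg hJ0
    nlinarith
  have hρm : 0 < ρ ^ (m + α : ℝ) := Real.rpow_pos_of_pos hρ _
  have hpt : ∀ r ∈ Ioo δ ρ, r ^ m * |v r| ≤ ρ ^ m + 2 * ρ ^ (m + α : ℝ) * J r := fun r hr => by
    have hr0 : 0 < r := hδ.trans hr.1
    have h1 : J r = r ^ (-α) * (v r / √(1 + v r ^ 2) * v r) := by
      rw [← hpow r hr0]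
      simp only [J]
      rw [hηeq r (by linarith [hr.1]) (by linarith [hr.2])]
      ring
    have h2 : r ^ m * (v r / √(1 + v r ^ 2) * v r) = r ^ (m + α : ℝ) * J r := by
      rw [h1, ← mul_assoc (r ^ _) (r ^ _), ← Real.rpow_add hr0, add_neg_cancel_right, Real.rpow_natCast]
    have h3 : r ^ (m + α : ℝ) ≤ ρ ^ (m + α : ℝ) :=
      Real.rpow_le_rpow hr0.le hr.2.le (by positivity)
    have h4 : r ^ m ≤ ρ ^ m := pow_le_pow_left₀ hr0.le hr.2.le m
    calc r ^ m * |v r| ≤ r ^ m * (1 + 2 * (v r / √(1 + v r ^ 2) * v r)) := by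
          gcongr
          exact abs_le_one_add_flux_mul _
      _ = r ^ m + 2 * (r ^ (m + α : ℝ) * J r) := by rw [← h2]; ring
      _ ≤ ρ ^ m + 2 * (ρ ^ (m + α : ℝ) * J r) := by
          have := hJ0 r
          gcongr
      _ = _ := by ring
  have hc : IntegrableOn (fun _ : ℝ => ρ ^ m) (Ioo δ ρ) := integrableOn_const (by simp)
  have hJi : IntegrableOn (fun r => 2 * ρ ^ (m + α : ℝ) * J r) (Ioo δ ρ) :=
    (hI.const_mul _).integrableOn
  calc ∫ r in Ioo δ ρ, r ^ m * |v r|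
      ≤ ∫ r in Ioo δ ρ, (ρ ^ m + 2 * ρ ^ (m + α : ℝ) * J r) := by
        refine setIntegral_mono_on ?_ (hc.add hJi) measurableSet_Ioo hpt
        exact ((continuous_pow m).mul hvc.abs).integrableOn_Icc.mono_set Ioo_subset_Icc_self
    _ = volume.real (Ioo δ ρ) * ρ ^ m + 2 * ρ ^ (m + α : ℝ) * ∫ r in Ioo δ ρ, J r := by
        rw [integral_add hc hJi, setIntegral_const, integral_const_mul, smul_eq_mul]
    _ ≤ ρ * ρ ^ m + 2 * ρ ^ (m + α : ℝ) * (D ^ 2 * L) := by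
        have h1 : volume.real (Ioo δ ρ) ≤ ρ := by
          rw [Measure.real, Real.volume_Ioo, ENNReal.toReal_ofReal']
          exact max_le (by linarith) hρ.le
        have h2 : ∫ r in Ioo δ ρ, J r ≤ ∫ r, J r := setIntegral_le_integral hI (ae_of_all _ hJ0)
        have h3 := h2.trans hJle
        gcongr
    _ ≤ ρ ^ (m + α : ℝ) + 2 * ρ ^ (m + α : ℝ) * (D ^ 2 * L) := by
        -- The contribution ρ^(m+1) of the constant 1 is below ρ^(m+α), as ρ < 1 and α < 1.
        have h1 : ρ * ρ ^ m = ρ ^ (m + 1 : ℝ) := by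
          rw [Real.rpow_add_one hρ.ne', Real.rpow_natCast, mul_comm]
        rw [h1]
        gcongr ?_ + _
        exact Real.rpow_le_rpow_of_exponent_ge hρ hρ1.le (by linarith)
    _ = _ := by ring

end MeanCurvature

/-! ### Back to the ball. -/

theorem proposition1p4 (n : ℕ) (hn : 2 ≤ n) (α : ℝ) (hα0 : 0 < α) (hα1 : α < 1) :
    ∃ K : ℝ, 0 < K ∧
      ∀ (f : ℝ → ℝ) (u : EuclideanSpace ℝ (Fin n) → ℝ)
        (Du : EuclideanSpace ℝ (Fin n) → EuclideanSpace ℝ (Fin n)),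
        ContDiff ℝ 1 f →
        MeanCurvature.MemSobolevLoc (Metric.ball 0 2) 3 u →
        MeanCurvature.IsStableSolution f (Metric.ball 0 2) u Du →
        MeanCurvature.IsRadialOn (Metric.ball 0 2) u →
        ∀ ρ : ℝ, 0 < ρ → ρ < 1 →
          IntegrableOn Du (Metric.ball 0 ρ) volume ∧
          ∫ x in Metric.ball 0 ρ, ‖Du x‖ ≤ K * ρ ^ ((n : ℝ) - 1 + α) := by
  obtain ⟨K, hK, hbound⟩ := MeanCurvature.exists_profile_bound (m := n - 1) (by omega) hα0 hα1
  have hn0 : 0 < n := by omega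
  have hS := MeanCurvature.sphereArea_pos hn0
  refine ⟨MeanCurvature.sphereArea n * K, by positivity, ?_⟩
  intro f u Du hf hu hsol hrad ρ hρ hρ1
  have hint : IntegrableOn Du (Metric.ball 0 ρ) volume :=
    (hsol.weakGradient.locInt_grad.integrableOn_compact_subset
      (Metric.closedBall_subset_ball (by linarith)) (isCompact_closedBall 0 ρ)).mono_set
        Metric.ball_subset_closedBall
  refine ⟨hint, ?_⟩
  have hu2 : MeanCurvature.MemSobolevLoc (Metric.ball 0 2) 2 u := by
    obtain ⟨Dv, hDv, h2⟩ := hu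
    refine ⟨Dv, hDv, fun i => ?_⟩
    obtain ⟨D2v, hD2v, h3⟩ := h2 i
    refine ⟨D2v, hD2v, fun j => ?_⟩
    obtain ⟨D3v, hD3v, -⟩ := h3 j
    exact hD3v.locInt
  -- G depends on δ but the bound does not, so δ can tend to 0.
  have hann : ∀ δ : ℝ, 0 < δ → δ ≤ 1 →
      ∫ x in {x : EuclideanSpace ℝ (Fin n) | ‖x‖ ∈ Set.Ioo δ ρ}, ‖Du x‖
        ≤ MeanCurvature.sphereArea n * K * ρ ^ ((n : ℝ) - 1 + α) := by
    intro δ hδ hδ1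
    obtain ⟨G, hG, hGu⟩ := MeanCurvature.exists_contDiff_profile hn0 (a := δ / 4) (b := 7 / 4)
      (by linarith) (by linarith) (by norm_num) hu2 hrad
    have hDu := hsol.weakGradient.ae_eq_of_profile (by linarith) (by norm_num) hG hGu
    have h1 := hbound δ ρ f G hδ hδ1 hρ hρ1 hf hG
      (fun χ hχ => hsol.toIsWeakSolution.profile_equation hn0 (by linarith) (by norm_num)
        hGu hDu hχ)
      (fun χ hχ => hsol.profile_stable hn0 (by linarith) (by norm_num) hGu hDu hχ)
    have hA : MeasurableSet {x : EuclideanSpace ℝ (Fin n) | ‖x‖ ∈ Set.Ioo δ ρ} :=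
      measurableSet_Ioo.preimage measurable_norm
    have h2 : ∫ x in {x : EuclideanSpace ℝ (Fin n) | ‖x‖ ∈ Set.Ioo δ ρ}, ‖Du x‖
        = ∫ x : EuclideanSpace ℝ (Fin n),
          (Set.Ioo δ ρ).indicator (fun r => |deriv G r|) ‖x‖ := by
      rw [← integral_indicator hA]
      refine integral_congr_ae ?_
      filter_upwards [hDu] with x hx
      by_cases hxA : ‖x‖ ∈ Set.Ioo δ ρ
      · have hx0 : 0 < ‖x‖ := hδ.trans hxA.1
        rw [Set.indicator_of_mem (show x ∈ {x : EuclideanSpace ℝ (Fin n) | ‖x‖ ∈ Set.Ioo δ ρ}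
          from hxA), Set.indicator_of_mem hxA, hx ⟨by linarith [hxA.1], by linarith [hxA.2]⟩,
          norm_smul, norm_mul, norm_inv, norm_norm, Real.norm_eq_abs]
        field_simp
      · rw [Set.indicator_of_notMem hxA, Set.indicator_of_notMem]
        exact hxA
    have h3 : ∫ r in Set.Ioi 0, r ^ (n - 1) * (Set.Ioo δ ρ).indicator (fun r => |deriv G r|) r
        = ∫ r in Set.Ioo δ ρ, r ^ (n - 1) * |deriv G r| := by
      rw [setIntegral_eq_integral_of_forall_compl_eq_zero, ← integral_indicator measurableSet_Ioo]
      · congr with r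
        by_cases hr : r ∈ Set.Ioo δ ρ
        · rw [Set.indicator_of_mem hr, Set.indicator_of_mem hr]
        · rw [Set.indicator_of_notMem hr, Set.indicator_of_notMem hr, mul_zero]
      · intro r hr
        rw [Set.indicator_of_notMem fun h => hr (hδ.trans h.1), mul_zero]
    rw [h2, MeanCurvature.integral_norm_eq hn0, h3, mul_assoc]
    have h4 : (((n - 1 : ℕ) : ℝ) + α) = (n : ℝ) - 1 + α := by
      rw [Nat.cast_sub (by omega), Nat.cast_one]
    rw [h4] at h1
    gcongr
  -- These annuli increase to the punctured ball, and the origin is a null set.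
  set A : ℕ → Set (EuclideanSpace ℝ (Fin n)) :=
    fun k => {x | ‖x‖ ∈ Set.Ioo (1 / ((k : ℝ) + 1)) ρ} with hAdef
  have hAU : ⋃ k, A k = Metric.ball 0 ρ \ {0} := by
    ext x
    simp only [A, Set.mem_iUnion, Set.mem_ofPred_eq, Set.mem_Ioo, Set.mem_sdiff, mem_ball_zero_iff,
      Set.mem_singleton_iff]
    constructor
    · rintro ⟨k, hk, hxρ⟩
      exact ⟨hxρ, norm_pos_iff.1 (lt_trans (by positivity) hk)⟩
    · rintro ⟨hxρ, hx0⟩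
      obtain ⟨k, hk⟩ := exists_nat_one_div_lt (norm_pos_iff.2 hx0)
      exact ⟨k, hk, hxρ⟩
  have hAm : Monotone A := fun i j hij x hx =>
    ⟨(one_div_le_one_div_of_le (by positivity) (by gcongr)).trans_lt hx.1, hx.2⟩
  have hlim := tendsto_setIntegral_of_monotone (μ := volume) (f := fun x => ‖Du x‖) (s := A)
    (fun k => measurableSet_Ioo.preimage measurable_norm) hAm
    (hAU ▸ IntegrableOn.mono_set hint.norm Set.sdiff_subset)
  have hball : ∫ x in Metric.ball 0 ρ, ‖Du x‖ = ∫ x in ⋃ k, A k, ‖Du x‖ := by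
    have := MeanCurvature.nontrivial_euclideanSpace hn0
    rw [hAU]
    refine setIntegral_congr_set ?_
    exact (sdiff_null_ae_eq_self (measure_singleton 0)).symm
  rw [hball]
  refine le_of_tendsto' hlim fun k => hann _ (by positivity) ?_
  rw [div_le_one (by positivity)]
  linarith [Nat.cast_nonneg (α := ℝ) k]
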